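/- \textbf{Setting.} Let $V$ be a finite-dimensional real inner product space and $R\subset V$ a finite, reduced, irreducible crystallographic root system in its span $V_s\subseteq V$, with reflections orthogonal for $(\cdot,\cdot)$. Let $F$ be a basis of simple roots of $R$ and $\theta$ the highest root. Let $Y\subset V$ be a lattice (a discrete subgroup, not necessarily of full rank) containing all coroots $\alpha^\vee=2\alpha/(\alpha,\alpha)$ and with $(y,\alpha)\in\mathbb Z$ for all $y\in Y$, $\alpha\in R$. Put $\widehat V=V\oplus\mathbb Rc\oplus\mathbb Rd$ and extend the scalar product to a symmetric bilinear form on $\widehat V$ by $(c,d)=1$, $(c,c)=(d,d)=(c,v)=(d,v)=0$ for $v\in V$; let $\widehat{\mathfrak h}=\mathbb C\otimes_{\mathbb R}\widehat V$, with the complex bilinear extension of the form. For $a\in\widehat V$ with $(a,a)\neq0$ put $s_a(\hat v)=\hat v-\frac{2(\hat v,a)}{(a,a)}a$, and for $u\in V$ put $$t_u(v+\eta c+\xi d)=v+\xi u+\bigl(\eta-\tfrac{\xi}{2}(u,u)-(v,u)\bigr)c+\xi d .$$ Let $\widehat R=\{\alpha+mc:\alpha\in R,\ m\in\mathbb Z\}$,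 $\widehat F=F\cup\{-\theta+c\}$, and let $\widehat R^+$ be the set of elements of $\widehat R$ that are nonnegative integral combinations of elements of $\widehat F$. Let $\widehat W^Y=W\ltimes Y$ be the group of linear automorphisms of $\widehat V$ generated by the $s_\alpha$ ($\alpha\in R$) and the $t_y$ ($y\in Y$); it contains all $s_a$ ($a\in\widehat R$). Let $\Omega=\{\omega\in\widehat W^Y:\omega(\widehat R^+)\subseteq\widehat R^+\}$. Let $k:\widehat R\to\mathbb C$, $a\mapsto k_a$, be a $\widehat W^Y$-invariant function. The extended trigonometric Cherednik algebra $\widehat H^Y(k)$ is the associative unital $\mathbb C$-algebra such that: it contains the symmetric algebra $S(\widehat{\mathfrak h})$ and the group algebra $\mathbb C[\widehat W^Y]$ as subalgebras; multiplication gives a linear isomorphism $S(\widehat{\mathfrak h})\otimes_{\mathbb C}\mathbb C[\widehat W^Y]\simeq\widehat H^Y(k)$; and for all $\hat v\in\widehat{\mathfrak h}$ $$s_a\cdot\hat v=s_a(\hat v)\cdot s_a-k_a(a,\hat v)\quad(a\in\widehat F),\qquad \omega\cdot\hat v=\omega(\hat v)\cdot\omega\quad(\omega\in\Omega).$$ Let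 $\widehat V^+=V\oplus\mathbb Rc\oplus\mathbb R_{>0}d$ and let $\mathcal C$ be the set of connected components (chambers) of $\{\hat v\in\widehat V^+:(a,\hat v)\ne0\ \forall a\in\widehat R\}$. For a finite-dimensional complex representation $(M,\pi_M)$ of $\widehat W^Y$ let $\mathcal F_M=\prod_{C\in\mathcal C}\bigl(C^\omega(\widehat V^+)\otimes_{\mathbb C}M\bigr)$, where $C^\omega(\widehat V^+)$ is the space of complex valued real analytic functions on $\widehat V^+$. The group $\widehat W^Y$ acts on $\mathcal F_M$ by $(wf)_C(\hat u)=\pi_M(w)\bigl(f_{w^{-1}C}(w^{-1}\hat u)\bigr)$. For $\hat v\in\widehat V$ let $\partial_{\hat v}$ be the componentwise directional derivative. For $a\in\widehat R^+$ let $\chi_a$ be the characteristic function of $\{\hat u:(a,\hat u)<0\}$, which is constant on each chamber, and also the operator $(\chi_af)_C=\chi_a(C)f_C$ on $\mathcal F_M$. \textbf{Proposition.} \begin{enumerate} \item The algebra $\widehat H^Y(k)$ is well defined: a $\mathbb C$-algebra with the listed properties exists, and between any two such algebras there is a unique algebra isomorphism compatible with the given embeddings of $S(\widehat{\mathfrak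 h})$ and $\mathbb C[\widehat W^Y]$. \item For each chamber $C$ there are only finitely many $a\in\widehat R^+$ with $\chi_a(C)\neq0$, so the affine Dunkl operators $$\mathcal D^M_{\hat v}f=\partial_{\hat v}f-\sum_{a\in\widehat R^+}k_a(a,\hat v)\,\chi_a s_af\qquad(\hat v\in\widehat V)$$ are well defined on $\mathcal F_M$; and for each finite-dimensional complex representation $M$ of $\widehat W^Y$ there is a unique algebra morphism $\hat\pi:\widehat H^Y(k)\to\mathrm{End}_{\mathbb C}(\mathcal F_M)$ with $\hat\pi(\hat v)=\mathcal D^M_{\hat v}$ for $\hat v\in\widehat V$ and $\hat\pi(w)=w$ for $w\in\widehat W^Y$. \end{enumerate} -/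

import Mathlib

open scoped TensorProduct InnerProductSpace

universe u₁ u₂ u₃ u₄ u₅

noncomputable section

namespace Cherednik

/-! ### The space `V ⊕ ℝ c ⊕ ℝ d` and its bilinear form -/

/-- `Vhat V = V ⊕ ℝ c ⊕ ℝ d`; the triple `(v, η, ξ)` stands for `v + η c + ξ d`. -/
abbrev Vhat (V : Type*) := V × ℝ × ℝ

/-- The complexification of `Vhat V`, that is `𝔥 ⊕ ℂ c ⊕ ℂ d` with `𝔥 = ℂ ⊗ V`. -/
abbrev Hhat (V : Type*) [AddCommGroup V] [Module ℝ V] := ℂ ⊗[ℝ] Vhat V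

section Space

variable {V : Type*} [NormedAddCommGroup V] [InnerProductSpace ℝ V]

/-- The symmetric bilinear form on `Vhat V` extending the scalar product of `V`, with
`(c, d) = 1` and `(c, c) = (d, d) = (c, v) = (d, v) = 0`. -/
def form : LinearMap.BilinForm ℝ (Vhat V) :=
  LinearMap.mk₂ ℝ (fun x y => ⟪x.1, y.1⟫_ℝ + x.2.1 * y.2.2 + x.2.2 * y.2.1)
    (fun x x' y => by simp [inner_add_left]; ring)
    (fun r x y => by simp [inner_smul_left]; ring)
    (fun x y y' => by simp [inner_add_right]; ring)
    (fun r x y => by simp [inner_smul_right]; ring)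

lemma form_apply (x y : Vhat V) :
    form x y = ⟪x.1, y.1⟫_ℝ + x.2.1 * y.2.2 + x.2.2 * y.2.1 := rfl

/-- The complex bilinear extension `v ↦ (a, v)` to `Hhat V`, for `a ∈ Vhat V`. -/
def formC (a : Vhat V) (v : Hhat V) : ℂ :=
  LinearMap.BilinForm.baseChange ℂ (form (V := V)) ((1 : ℂ) ⊗ₜ[ℝ] a) v

/-- `s_a v = v - (v, a^∨) a` with `a^∨ = 2 a / (a, a)`. It is only used for `(a, a) ≠ 0`. -/
def reflFun (a : Vhat V) : Vhat V →ₗ[ℝ] Vhat V :=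
  LinearMap.id - (form.flip ((2 / form a a) • a)).smulRight a

lemma reflFun_apply (a v : Vhat V) :
    reflFun a v = v - form v ((2 / form a a) • a) • a := rfl

lemma reflFun_involutive (a : Vhat V) : Function.Involutive (reflFun a) := by
  intro v
  by_cases h : form a a = 0
  · simp [reflFun_apply, h]
  · simp only [reflFun_apply, map_sub, map_smul, smul_eq_mul]
    rw [div_mul_cancel₀ _ h]
    module

/-- The reflection `s_a` as a linear automorphism of `Vhat V`. -/
def refl (a : Vhat V) : Vhat V ≃ₗ[ℝ] Vhat V :=
  LinearEquiv.ofInvolutive (reflFun a) (reflFun_involutive a)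

lemma refl_apply (a v : Vhat V) : refl a v = v - form v ((2 / form a a) • a) • a := rfl

/-- `t_u (v + η c + ξ d) = v + ξ u + (η - (ξ / 2) (u, u) - (v, u)) c + ξ d`. -/
def transFun (u : V) : Vhat V →ₗ[ℝ] Vhat V where
  toFun x := (x.1 + x.2.2 • u, x.2.1 - x.2.2 / 2 * ⟪u, u⟫_ℝ - ⟪x.1, u⟫_ℝ, x.2.2)
  map_add' x y := by
    refine Prod.ext ?_ (Prod.ext ?_ rfl)
    · simp only [Prod.fst_add, Prod.snd_add]; module
    · simp only [Prod.fst_add, Prod.snd_add, inner_add_left]; ring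
  map_smul' r x := by
    refine Prod.ext ?_ (Prod.ext ?_ rfl)
    · simp [mul_smul]
    · simp [inner_smul_left]; ring

lemma transFun_neg (u : V) (x : Vhat V) : transFun (-u) (transFun u x) = x := by
  refine Prod.ext ?_ (Prod.ext ?_ rfl)
  · simp [transFun]
  · simp [transFun, inner_add_left, inner_smul_left]; ring

/-- The transformation `t_u` as a linear automorphism of `Vhat V`. -/
def trans (u : V) : Vhat V ≃ₗ[ℝ] Vhat V :=
  LinearEquiv.ofLinearMap (transFun u) (transFun (-u))
    (LinearMap.ext fun x => by simpa using transFun_neg (-u) x)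
    (LinearMap.ext fun x => transFun_neg u x)

lemma trans_apply (u : V) (x : Vhat V) :
    trans u x = (x.1 + x.2.2 • u, x.2.1 - x.2.2 / 2 * ⟪u, u⟫_ℝ - ⟪x.1, u⟫_ℝ, x.2.2) := rfl

/-- `Vplus V = V ⊕ ℝ c ⊕ ℝ_{>0} d`. -/
def Vplus (V : Type*) : Set (Vhat V) := {x | 0 < x.2.2}

end Space

lemma isOpen_Vplus {V : Type*} [TopologicalSpace V] : IsOpen (Vplus V) :=
  isOpen_lt continuous_const (continuous_snd.comp continuous_snd)

/-! ### Affine root systems and extended affine Weyl groups -/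

/-- A Euclidean space `V`, an irreducible reduced crystallographic finite root system `R` spanning
a subspace `Vs` of `V`, a basis of simple roots with its highest root, and a lattice `Y` in `V`
which contains the coroots and pairs integrally with the roots. -/
structure AffineDatum (ι V : Type*) [NormedAddCommGroup V] [InnerProductSpace ℝ V] where
  /-- The real span of the root system. -/
  Vs : Submodule ℝ V
  /-- The root system. -/
  P : RootPairing ι ℝ Vs (Module.Dual ℝ Vs)
  finite : Finite ι
  isRootSystem : P.IsRootSystem
  reduced : P.IsReduced
  crystallographic : P.IsCrystallographic
  irreducible : P.IsIrreducible
  /-- The reflections of the root system are orthogonal: the coroot of `α`, as a linear functional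
  on `Vs`, is `2 (α, ·) / (α, α)`. -/
  coroot_eq : ∀ i x, P.coroot' i x =
    2 / ⟪(P.root i : V), (P.root i : V)⟫_ℝ * ⟪(P.root i : V), (x : V)⟫_ℝ
  /-- The simple roots. -/
  base : P.Base
  /-- The index of the highest root. -/
  θ : ι
  /-- Subtracting any root from the highest root gives a nonnegative integral combination of
  simple roots. -/
  highest : ∀ i, P.root θ - P.root i ∈ AddSubmonoid.closure (P.root '' base.support)
  /-- The lattice. -/
  Y : AddSubgroup V
  discrete : DiscreteTopology Y
  coroot_mem : ∀ i, (2 / ⟪(P.root i : V), (P.root i : V)⟫_ℝ) • (P.root i : V) ∈ Y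
  pairing_int : ∀ y ∈ Y, ∀ i, ∃ n : ℤ, ⟪y, (P.root i : V)⟫_ℝ = n

namespace AffineDatum

variable {ι V : Type*} [NormedAddCommGroup V] [InnerProductSpace ℝ V] (D : AffineDatum ι V)

/-- The roots, as vectors of `V`. -/
def root (i : ι) : V := (D.P.root i : V)

/-- The affine root `α + m c`. -/
def affRoot (i : ι) (m : ℤ) : Vhat V := (D.root i, (m : ℝ), 0)

/-- The affine root system `{α + m c}`. -/
def affRoots : Set (Vhat V) := {a | ∃ i m, a = D.affRoot i m}

/-- The simple affine roots: `a_0 = -θ + c` and the simple roots of `R`. -/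
def affSimple : Set (Vhat V) :=
  insert (-D.root D.θ, 1, 0) ((fun i => D.affRoot i 0) '' D.base.support)

/-- The positive affine roots: the nonnegative integral combinations of simple affine roots. -/
def posRoots : Set (Vhat V) := {a | a ∈ D.affRoots ∧ a ∈ AddSubmonoid.closure D.affSimple}

/-- The extended affine Weyl group `W ⋉ Y`, inside the group of linear automorphisms of `Vhat V`:
it is generated by the reflections `s_α` (`α ∈ R`) and the translations `t_y` (`y ∈ Y`). -/
def extWeyl : Subgroup (Vhat V ≃ₗ[ℝ] Vhat V) :=
  Subgroup.closure ((Set.range fun i => refl (D.affRoot i 0)) ∪ trans '' (D.Y : Set V))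

/-- The elements `ω` of the extended affine Weyl group that preserve the positive affine roots. -/
def IsOmega (w : D.extWeyl) : Prop := ∀ a ∈ D.posRoots, w.1 a ∈ D.posRoots

/-- The functions on the affine root system that are invariant under the extended affine
Weyl group. -/
def IsMultiplicity (k : D.affRoots → ℂ) : Prop :=
  ∀ w ∈ D.extWeyl, ∀ a b : D.affRoots, w a.1 = b.1 → k b = k a

/-- The regular elements of `Vplus V`. -/
def reg : Set (Vhat V) := {x | x ∈ Vplus V ∧ ∀ a ∈ D.affRoots, form a x ≠ 0}

/-! Elementary facts on the affine root system. -/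

lemma root_ne_zero (i : ι) : D.root i ≠ 0 := by
  have := D.P.ne_zero i
  simpa [root] using this

lemma inner_root_ne_zero (i : ι) : ⟪D.root i, D.root i⟫_ℝ ≠ 0 :=
  inner_self_ne_zero.2 (D.root_ne_zero i)

lemma exists_neg (i : ι) : ∃ j, D.root j = -D.root i := by
  refine ⟨D.P.reflectionPerm i i, ?_⟩
  have h := D.P.reflectionPerm_root i i
  rw [D.P.root_coroot_two] at h
  rw [root, root, ← h]
  push_cast
  module

lemma exists_refl (i j : ι) :
    ∃ l, D.root l =
      D.root j - (2 / ⟪D.root i, D.root i⟫_ℝ * ⟪D.root i, D.root j⟫_ℝ) • D.root i := by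
  refine ⟨D.P.reflectionPerm i j, ?_⟩
  have h := D.P.reflectionPerm_root i j
  have h2 : D.P.toLinearMap (D.P.root j) (D.P.coroot i) = D.P.coroot' i (D.P.root j) := rfl
  rw [h2, D.coroot_eq] at h
  rw [root, ← h]
  rfl

lemma form_affRoot_self (i : ι) (m : ℤ) :
    form (D.affRoot i m) (D.affRoot i m) = ⟪D.root i, D.root i⟫_ℝ := by
  simp [form_apply, affRoot]

lemma form_self_ne_zero {a : Vhat V} (ha : a ∈ D.affRoots) : form a a ≠ 0 := by
  obtain ⟨i, m, rfl⟩ := ha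
  rw [form_affRoot_self]
  exact D.inner_root_ne_zero i

lemma simple_subset : D.affSimple ⊆ D.affRoots := by
  rintro a (rfl | ⟨i, -, rfl⟩)
  · obtain ⟨j, hj⟩ := D.exists_neg D.θ
    exact ⟨j, 1, by simp [affRoot, hj]⟩
  · exact ⟨i, 0, rfl⟩

/-- `s_{α + m c} = s_α t_{m α^∨}`. -/
lemma refl_affRoot (i : ι) (m : ℤ) :
    refl (D.affRoot i m) = refl (D.affRoot i 0) *
      trans (m • ((2 / ⟪D.root i, D.root i⟫_ℝ) • D.root i)) := by
  have h := D.inner_root_ne_zero i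
  refine LinearEquiv.ext fun x => ?_
  rw [LinearEquiv.mul_apply]
  simp only [refl_apply, form_affRoot_self, trans_apply, map_smul]
  simp only [form_apply, affRoot, ← Int.cast_smul_eq_zsmul ℝ]
  set N := ⟪D.root i, D.root i⟫_ℝ with hN
  refine Prod.ext ?_ (Prod.ext ?_ ?_)
  · simp only [Prod.fst_sub, Prod.smul_fst, inner_add_left, inner_smul_left, smul_eq_mul]
    simp only [smul_smul, add_sub_assoc, ← sub_smul, ← hN]
    rw [sub_eq_add_neg, ← neg_smul]
    congr 2
    simp
    field_simp
    ring
  · simp only [Prod.snd_sub, Prod.fst_sub, Prod.smul_snd, Prod.smul_fst, inner_add_left,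
      inner_smul_left, inner_smul_right, ← hN, smul_eq_mul, conj_trivial, Int.cast_zero]
    field_simp
    ring
  · simp

/-- The reflections in affine roots lie in the extended affine Weyl group. -/
lemma refl_mem {a : Vhat V} (ha : a ∈ D.affRoots) : refl a ∈ D.extWeyl := by
  obtain ⟨i, m, rfl⟩ := ha
  rw [refl_affRoot]
  refine mul_mem (Subgroup.subset_closure (Or.inl ⟨i, rfl⟩))
    (Subgroup.subset_closure (Or.inr ⟨_, ?_, rfl⟩))
  exact D.Y.zsmul_mem (D.coroot_mem i) m

/-- The reflection in an affine root as an element of the extended affine Weyl group. -/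
def s (a : D.affRoots) : D.extWeyl := ⟨refl a.1, D.refl_mem a.2⟩

lemma form_refl (a x y : Vhat V) : form (refl a x) (refl a y) = form x y := by
  have hs : ∀ x y : Vhat V, form x y = form y x := fun x y => by
    simp only [form_apply, real_inner_comm]; ring
  by_cases h : form a a = 0
  · simp [refl_apply, h]
  · simp only [refl_apply, map_sub, map_smul, LinearMap.sub_apply, LinearMap.smul_apply,
      smul_eq_mul]
    rw [hs a y]
    field_simp
    ring

lemma form_trans (u : V) (x y : Vhat V) : form (trans u x) (trans u y) = form x y := by
  simp only [form_apply, trans_apply, inner_add_left, inner_add_right, inner_smul_left,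
    inner_smul_right, real_inner_comm u, conj_trivial]
  ring

/-- What the generators of the extended affine Weyl group preserve. -/
lemma mem_preserves {w : Vhat V ≃ₗ[ℝ] Vhat V} (hw : w ∈ D.extWeyl) :
    (∀ x y, form (w x) (w y) = form x y) ∧ (∀ x, (w x).2.2 = x.2.2) ∧
      ∀ a, w a ∈ D.affRoots ↔ a ∈ D.affRoots := by
  have key : ∀ g : Vhat V ≃ₗ[ℝ] Vhat V, ∀ h : Vhat V → Vhat V, (∀ x, g (h x) = x) →
      (∀ a ∈ D.affRoots, g a ∈ D.affRoots) → (∀ a ∈ D.affRoots, h a ∈ D.affRoots) →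
      ∀ a, g a ∈ D.affRoots ↔ a ∈ D.affRoots := by
    intro g h hgh hg hh a
    refine ⟨fun ha => ?_, hg a⟩
    have h1 := hh _ ha
    have h2 : h (g a) = a := g.injective (hgh _)
    rwa [h2] at h1
  induction hw using Subgroup.closure_induction with
  | mem w hw =>
    rcases hw with ⟨i, rfl⟩ | ⟨y, hy, rfl⟩
    · refine ⟨form_refl _, fun x => by simp [refl_apply, affRoot], ?_⟩
      have hm : ∀ a ∈ D.affRoots, refl (D.affRoot i 0) a ∈ D.affRoots := by
        rintro _ ⟨j, m, rfl⟩
        obtain ⟨l, hl⟩ := D.exists_refl i j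
        refine ⟨l, m, ?_⟩
        rw [refl_apply, form_affRoot_self, map_smul]
        simp only [form_apply, affRoot, hl, real_inner_comm (D.root i)]
        refine Prod.ext ?_ (Prod.ext ?_ ?_) <;> simp
      exact key _ _ (reflFun_involutive _) hm hm
    · refine ⟨form_trans _, fun x => rfl, ?_⟩
      have hm : ∀ y ∈ D.Y, ∀ a ∈ D.affRoots, trans y a ∈ D.affRoots := by
        rintro y hy _ ⟨j, m, rfl⟩
        obtain ⟨n, hn⟩ := D.pairing_int y hy j
        refine ⟨j, m - n, ?_⟩
        have hn' : ⟪D.root j, y⟫_ℝ = n := by rw [real_inner_comm]; exact hn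
        simp [trans_apply, affRoot, hn']
      refine key _ (trans (-y)) (fun x => ?_) (hm y hy) (hm _ (D.Y.neg_mem hy))
      have h := transFun_neg (-y) x
      rwa [neg_neg] at h
  | one => exact ⟨fun _ _ => rfl, fun _ => rfl, fun _ => Iff.rfl⟩
  | mul g h _ _ hg hh =>
    refine ⟨fun x y => ?_, fun x => ?_, fun a => ?_⟩
    · rw [LinearEquiv.mul_apply, LinearEquiv.mul_apply, hg.1, hh.1]
    · rw [LinearEquiv.mul_apply, hg.2.1, hh.2.1]
    · rw [LinearEquiv.mul_apply, hg.2.2, hh.2.2]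
  | inv g _ hg =>
    have e : ∀ x, g (g⁻¹ x) = x := fun x => by
      rw [← LinearEquiv.mul_apply, mul_inv_cancel]
      rfl
    refine ⟨fun x y => ?_, fun x => ?_, fun a => ?_⟩
    · rw [← hg.1, e, e]
    · rw [← hg.2.1, e]
    · rw [← hg.2.2, e]

lemma apply_inv_apply (w : D.extWeyl) (x : Vhat V) : w.1 ((w⁻¹).1 x) = x := by
  rw [← LinearEquiv.mul_apply, ← Subgroup.coe_mul, mul_inv_cancel]
  rfl

lemma mem_Vplus_iff (w : D.extWeyl) (x : Vhat V) : w.1 x ∈ Vplus V ↔ x ∈ Vplus V := by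
  rw [Vplus, Set.mem_ofPred_eq, Set.mem_ofPred_eq, (D.mem_preserves w.2).2.1]

lemma mem_reg (w : D.extWeyl) {x : Vhat V} (hx : x ∈ D.reg) : w.1 x ∈ D.reg := by
  refine ⟨(D.mem_Vplus_iff w x).2 hx.1, fun a ha => ?_⟩
  rw [← D.apply_inv_apply w a, (D.mem_preserves w.2).1]
  exact hx.2 _ (((D.mem_preserves (w⁻¹).2).2.2 a).2 ha)

/-! ### Chambers and the representation space -/

/-- The chambers: the connected components of the set of regular elements. -/
def Chamber : Type _ := {C : Set (Vhat V) // ∃ x ∈ D.reg, C = connectedComponentIn D.reg x}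

variable [FiniteDimensional ℝ V]

lemma image_reg (w : D.extWeyl) :
    w.1.toContinuousLinearEquiv.toHomeomorph '' D.reg = D.reg := by
  refine Set.Subset.antisymm ?_ fun x hx => ?_
  · rintro _ ⟨x, hx, rfl⟩
    exact D.mem_reg w hx
  · exact ⟨(w⁻¹).1 x, D.mem_reg w⁻¹ hx, D.apply_inv_apply w x⟩

/-- The chamber `w C`. -/
def chamberMap (w : D.extWeyl) (C : D.Chamber) : D.Chamber :=
  ⟨w.1 '' C.1, by
    obtain ⟨_, x, hx, rfl⟩ := C
    refine ⟨w.1 x, D.mem_reg w hx, ?_⟩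
    have h := Homeomorph.image_connectedComponentIn
      w.1.toContinuousLinearEquiv.toHomeomorph hx
    rw [image_reg] at h
    exact h⟩

open Classical in
/-- The value on a chamber of the characteristic function of `{v | (a, v) < 0}`. -/
def chi (a : Vhat V) (C : D.Chamber) : ℂ := if ∀ x ∈ C.1, form a x < 0 then 1 else 0

/-- On a chamber, `(a, ·)` has constant sign for each affine root `a`; so `chi` is the constant
value of the characteristic function. -/
lemma chi_eq (a : Vhat V) (ha : a ∈ D.affRoots) (C : D.Chamber) (x : Vhat V) (hx : x ∈ C.1) :
    D.chi a C = Set.indicator {v | form a v < 0} 1 x := by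
  classical
  obtain ⟨_, y, hy, rfl⟩ := C
  have hsub : connectedComponentIn D.reg y ⊆ D.reg := connectedComponentIn_subset _ _
  have hcont : Continuous fun v : Vhat V => form a v :=
    LinearMap.continuous_of_finiteDimensional (form a)
  have hpre := (isPreconnected_connectedComponentIn (F := D.reg) (x := y)).image _
    hcont.continuousOn
  by_cases h : form a x < 0
  · rw [Set.indicator_of_mem (by exact h), Pi.one_apply]
    refine if_pos ?_
    intro z hz
    by_contra hz'
    obtain ⟨t, ht, ht0⟩ := hpre.ordConnected.out ⟨x, hx, rfl⟩ ⟨z, hz, rfl⟩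
      ⟨h.le, not_lt.1 hz'⟩
    exact (hsub ht).2 a ha ht0
  · rw [Set.indicator_of_notMem (by exact h)]
    exact if_neg fun h' => h (h' x hx)

end AffineDatum

/-- The complex valued real analytic functions on `Vplus V`. Such a function is represented by its
extension by zero to `Vhat V`. -/
def analyticSubmodule (V : Type*) [NormedAddCommGroup V] [InnerProductSpace ℝ V] :
    Submodule ℂ (Vhat V → ℂ) where
  carrier := {f | AnalyticOnNhd ℝ f (Vplus V) ∧ ∀ x, x ∉ Vplus V → f x = 0}
  zero_mem' := ⟨analyticOnNhd_const, fun _ _ => rfl⟩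
  add_mem' hf hg := ⟨hf.1.add hg.1, fun x hx => by simp [hf.2 x hx, hg.2 x hx]⟩
  smul_mem' r f hf := ⟨analyticOnNhd_const.mul hf.1, fun x hx => by simp [hf.2 x hx]⟩

/-- The space `C^ω(Vplus V)` of complex valued real analytic functions on `Vplus V`. -/
def Analytic (V : Type*) [NormedAddCommGroup V] [InnerProductSpace ℝ V] : Type _ :=
  analyticSubmodule V

instance (V : Type*) [NormedAddCommGroup V] [InnerProductSpace ℝ V] :
    AddCommGroup (Analytic V) :=
  inferInstanceAs (AddCommGroup (analyticSubmodule V))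

instance (V : Type*) [NormedAddCommGroup V] [InnerProductSpace ℝ V] :
    Module ℂ (Analytic V) :=
  inferInstanceAs (Module ℂ (analyticSubmodule V))

section Operators

variable {V : Type*} [NormedAddCommGroup V] [InnerProductSpace ℝ V]

open Classical in
/-- The directional derivative `∂_v` of real analytic functions on `Vplus V`. -/
def partialDeriv (v : Vhat V) : Analytic V →ₗ[ℂ] Analytic V where
  toFun f := ⟨fun x => if x ∈ Vplus V then lineDeriv ℝ f.1 x v else 0, by
    refine ⟨?_, fun x hx => if_neg hx⟩
    have h1 : AnalyticOnNhd ℝ (fun x => fderiv ℝ f.1 x v) (Vplus V) := fun x hx =>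
      (ContinuousLinearMap.apply ℝ ℂ v).analyticAt _ |>.comp (f.2.1.fderiv x hx)
    refine h1.congr isOpen_Vplus fun x hx => ?_
    simp only [if_pos hx]
    exact ((f.2.1 x hx).differentiableAt.lineDeriv_eq_fderiv).symm⟩
  map_add' f g := by
    refine Subtype.ext (funext fun x => ?_)
    change (if x ∈ Vplus V then lineDeriv ℝ (f.1 + g.1) x v else 0) =
      (if x ∈ Vplus V then lineDeriv ℝ f.1 x v else 0) +
        (if x ∈ Vplus V then lineDeriv ℝ g.1 x v else 0)
    by_cases hx : x ∈ Vplus V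
    · have hf := (f.2.1 x hx).differentiableAt
      have hg := (g.2.1 x hx).differentiableAt
      have h1 := (hf.hasFDerivAt.add hg.hasFDerivAt).hasLineDerivAt v
      simp only [if_pos hx]
      rw [hf.lineDeriv_eq_fderiv, hg.lineDeriv_eq_fderiv]
      exact h1.lineDeriv
    · simp [hx]
  map_smul' r f := by
    refine Subtype.ext (funext fun x => ?_)
    change (if x ∈ Vplus V then lineDeriv ℝ (r • f.1) x v else 0) =
      r • (if x ∈ Vplus V then lineDeriv ℝ f.1 x v else 0)
    by_cases hx : x ∈ Vplus V
    · have hf := (f.2.1 x hx).differentiableAt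
      have h1 := (hf.hasFDerivAt.const_smul r).hasLineDerivAt v
      simp only [if_pos hx]
      rw [hf.lineDeriv_eq_fderiv]
      exact h1.lineDeriv
    · simp [hx]

namespace AffineDatum

variable {ι : Type*} (D : AffineDatum ι V) [FiniteDimensional ℝ V]

/-- The action `(w f)(v) = f (w⁻¹ v)` on real analytic functions. -/
def pull (w : D.extWeyl) : Analytic V →ₗ[ℂ] Analytic V where
  toFun f := ⟨fun x => f.1 ((w⁻¹).1 x), by
    refine ⟨fun x hx => ?_, fun x hx => f.2.2 _ (by rwa [mem_Vplus_iff])⟩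
    exact (f.2.1 _ ((D.mem_Vplus_iff w⁻¹ x).2 hx)).comp
      ((w⁻¹).1.toContinuousLinearEquiv.toContinuousLinearMap.analyticAt x)⟩
  map_add' _ _ := rfl
  map_smul' _ _ := rfl

/-- `F_M`: the product over the chambers of the spaces `C^ω(Vplus V) ⊗ M`. -/
abbrev FM (M : Type*) [AddCommGroup M] [Module ℂ M] := D.Chamber → Analytic V ⊗[ℂ] M

variable {M : Type*} [AddCommGroup M] [Module ℂ M]

/-- The action `(w f)_C (v) = π(w) (f_{w⁻¹ C} (w⁻¹ v))` on `F_M`. -/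
def act (π : Representation ℂ D.extWeyl M) (w : D.extWeyl) : Module.End ℂ (D.FM M) :=
  LinearMap.pi fun C =>
    TensorProduct.map (D.pull w) (π w) ∘ₗ LinearMap.proj (D.chamberMap w⁻¹ C)

/-- The componentwise directional derivative on `F_M`. -/
def deriv (M : Type*) [AddCommGroup M] [Module ℂ M] (v : Vhat V) : Module.End ℂ (D.FM M) :=
  LinearMap.pi fun C => LinearMap.rTensor M (partialDeriv v) ∘ₗ LinearMap.proj C

/-- Componentwise multiplication by the characteristic function of `{v | (a, v) < 0}`. -/
def chiOp (M : Type*) [AddCommGroup M] [Module ℂ M] (a : Vhat V) : Module.End ℂ (D.FM M) :=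
  LinearMap.pi fun C => D.chi a C • LinearMap.proj C

/-- The operator `∑_{a > 0} k_a (a, v) χ_a s_a` on `F_M`. The sum is taken in each component
separately, where only finitely many `χ_a` are nonzero. -/
def dunklSum (k : D.affRoots → ℂ) (π : Representation ℂ D.extWeyl M) (v : Vhat V) :
    Module.End ℂ (D.FM M) :=
  LinearMap.pi fun C => ∑ᶠ a : D.posRoots,
    (k ⟨a.1, a.2.1⟩ * (form a.1 v : ℝ)) •
      (LinearMap.proj C ∘ₗ D.chiOp M a.1 ∘ₗ D.act π (D.s ⟨a.1, a.2.1⟩))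

/-- The affine Dunkl operator `∂_v - ∑_{a > 0} k_a (a, v) χ_a s_a` on `F_M`. -/
def dunkl (k : D.affRoots → ℂ) (π : Representation ℂ D.extWeyl M) (v : Vhat V) :
    Module.End ℂ (D.FM M) :=
  D.deriv M v - D.dunklSum k π v

end AffineDatum

/-! ### The extended trigonometric Cherednik algebra -/

/-- The data and the properties that make a `ℂ`-algebra `H` the extended trigonometric Cherednik
algebra with multiplicity function `k`. -/
structure CherednikStructure {ι : Type*} (D : AffineDatum ι V) (k : D.affRoots → ℂ)
    (H : Type*) [Ring H] [Algebra ℂ H] where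
  /-- The inclusion of the symmetric algebra. -/
  incS : SymmetricAlgebra ℂ (Hhat V) →ₐ[ℂ] H
  /-- The inclusion of the group algebra. -/
  incW : MonoidAlgebra ℂ D.extWeyl →ₐ[ℂ] H
  incS_injective : Function.Injective incS
  incW_injective : Function.Injective incW
  /-- The multiplication map is a linear isomorphism. -/
  mul_bijective : Function.Bijective
    (LinearMap.mul' ℂ H ∘ₗ TensorProduct.map incS.toLinearMap incW.toLinearMap)
  /-- `s_a v = s_a(v) s_a - k_a (a, v)` for the simple affine roots `a`. -/
  cross_simple : ∀ (a : D.affRoots), a.1 ∈ D.affSimple → ∀ v : Hhat V,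
    incW (MonoidAlgebra.of ℂ _ (D.s a)) * incS (SymmetricAlgebra.ι ℂ _ v) =
      incS (SymmetricAlgebra.ι ℂ _ ((refl a.1).toLinearMap.baseChange ℂ v)) *
        incW (MonoidAlgebra.of ℂ _ (D.s a)) - algebraMap ℂ H (k a * formC a.1 v)
  /-- `ω v = ω(v) ω` for the elements `ω` that preserve the positive affine roots. -/
  cross_omega : ∀ ω : D.extWeyl, D.IsOmega ω → ∀ v : Hhat V,
    incW (MonoidAlgebra.of ℂ _ ω) * incS (SymmetricAlgebra.ι ℂ _ v) =
      incS (SymmetricAlgebra.ι ℂ _ (ω.1.toLinearMap.baseChange ℂ v)) *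
        incW (MonoidAlgebra.of ℂ _ ω)

end Operators

end Cherednik

end

open scoped TensorProduct InnerProductSpace

noncomputable section

namespace Cherednik

namespace AffineDatum

/-! ### Positive roots -/

section Roots

variable {ι V : Type*} [NormedAddCommGroup V] [InnerProductSpace ℝ V] (D : AffineDatum ι V)

/-! The algebra is realised by operators. For any representation `M`, the affine Dunkl operators and
the group action on `F_M` satisfy the cross relations. Taking `M` to be the regular representation
makes the products `p w` linearly independent, so their span is a model of the algebra.

The cross relation for a simple reflection `s_a` (`act_simple_mul_dunkl`) holds because conjugation
by `s_a` permutes the terms of the Dunkl sum, except that the term of `a` becomes that of `-a`.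
Since `χ_{-a} = 1 - χ_a`, the discrepancy is the scalar `k_a (a, v)`. Elements of `Ω` permute all
the terms.

Commutativity (`dunkl_comm`) needs no rank-two computation. On the fundamental chamber every `χ_a`
with `a > 0` vanishes, so the Dunkl operators are plain derivatives there and commute. The cross
relation shows that `s_a` intertwines `[D_u, D_v]` with `[D_{s_a u}, D_{s_a v}]`, which carries the
vanishing from `s_a C` to `C`. Every chamber is reached by simple reflections (`chamber_induction`);
the same descent shows that simple reflections and `Ω` generate the group (`generators_induction`).

Faithfulness (`mulMap_dunkl_injective`) is tested on `e^l ⊗ 1`. The component of `∑ p_w w (e^l ⊗ 1)`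
on the fundamental chamber is `∑ p_w(l ∘ w⁻¹) e^{l ∘ w⁻¹} ⊗ w`. If it vanishes for all `l`, each
polynomial `p_w` vanishes at every point.

Uniqueness and the representation on `F_M` both come from a universal property (`exists_lift`).
Given any pair of morphisms into `A` satisfying the cross relations, the span of the products `p w`
inside `H × A` is a subalgebra, and it is the graph of the required morphism because multiplication
is bijective in `H`. -/

lemma form_comm (x y : Vhat V) : form x y = form y x := by
  simp only [form_apply, real_inner_comm]; ring

lemma neg_mem_affRoots {a : Vhat V} (ha : a ∈ D.affRoots) : -a ∈ D.affRoots := by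
  obtain ⟨i, m, rfl⟩ := ha
  obtain ⟨j, hj⟩ := D.exists_neg i
  exact ⟨j, -m, by simp [affRoot, hj]⟩

lemma ne_zero_of_mem_affRoots {a : Vhat V} (ha : a ∈ D.affRoots) : a ≠ 0 := by
  rintro rfl
  exact D.form_self_ne_zero ha (by simp)

lemma simple_subset_posRoots : D.affSimple ⊆ D.posRoots := fun _ ha =>
  ⟨D.simple_subset ha, AddSubmonoid.subset_closure ha⟩

/-- The embedding of `Vs` in `Vhat V`. -/
def inclSpan : D.Vs →+ Vhat V where
  toFun v := (v, 0, 0)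
  map_zero' := rfl
  map_add' v w := by simp

lemma inclSpan_mem_closure {v : D.Vs}
    (hv : v ∈ AddSubmonoid.closure (D.P.root '' D.base.support)) :
    D.inclSpan v ∈ AddSubmonoid.closure D.affSimple := by
  have h : AddSubmonoid.closure (D.P.root '' D.base.support) ≤
      (AddSubmonoid.closure D.affSimple).comap D.inclSpan := by
    rw [AddSubmonoid.closure_le]
    rintro _ ⟨i, hi, rfl⟩
    refine AddSubmonoid.subset_closure (Or.inr ⟨i, hi, ?_⟩)
    simp [inclSpan, affRoot, root]
  exact h hv

/-- If `-θ` were the positive one, then `θ = (θ - (-θ)) + (-θ)` would still be a sum of positive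
elements. -/
lemma highest_mem_closure :
    D.P.root D.θ ∈ AddSubmonoid.closure (D.P.root '' D.base.support) := by
  rcases D.base.root_mem_or_neg_mem D.θ with h | h
  · exact h
  · obtain ⟨j, hj⟩ := D.exists_neg D.θ
    have hj' : D.P.root j = -D.P.root D.θ := Subtype.ext hj
    have h2 := add_mem (D.highest j) h
    rwa [hj', show D.P.root D.θ - -D.P.root D.θ + -D.P.root D.θ = D.P.root D.θ by abel] at h2

/-- Write `α + (n + 1) c = (θ - (-α)) + n θ + (n + 1)(-θ + c)`; maximality of `θ` makes the first
summand positive. -/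
lemma affRoot_mem_posRoots (i : ι) (n : ℕ) : D.affRoot i (n + 1) ∈ D.posRoots := by
  refine ⟨⟨i, _, rfl⟩, ?_⟩
  obtain ⟨j, hj⟩ := D.exists_neg i
  have h1 := D.inclSpan_mem_closure (add_mem (D.highest j)
    (nsmul_mem D.highest_mem_closure n))
  have h2 : ((-D.root D.θ, 1, 0) : Vhat V) ∈ AddSubmonoid.closure D.affSimple :=
    AddSubmonoid.subset_closure (Or.inl rfl)
  have h3 := add_mem h1 (nsmul_mem h2 (n + 1))
  convert h3 using 1
  have hj' : (D.P.root j : V) = -D.P.root i := hj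
  refine Prod.ext ?_ (Prod.ext ?_ ?_)
  · simp [inclSpan, affRoot, root, hj', add_smul]
  · simp [inclSpan, affRoot]
  · simp [inclSpan, affRoot]

lemma mem_posRoots_or_neg_mem {a : Vhat V} (ha : a ∈ D.affRoots) :
    a ∈ D.posRoots ∨ -a ∈ D.posRoots := by
  obtain ⟨i, m, rfl⟩ := ha
  obtain ⟨j, hj⟩ := D.exists_neg i
  have hneg : ∀ m : ℤ, -D.affRoot i m = D.affRoot j (-m) := fun m => by simp [affRoot, hj]
  rcases lt_trichotomy m 0 with hm | rfl | hm
  · right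
    obtain ⟨n, hn⟩ : ∃ n : ℕ, -m = n + 1 := ⟨(-m - 1).toNat, by omega⟩
    rw [hneg, hn]
    exact D.affRoot_mem_posRoots j n
  · refine (D.base.root_mem_or_neg_mem i).imp (fun h => ⟨⟨i, 0, rfl⟩, ?_⟩)
      (fun h => ⟨D.neg_mem_affRoots ⟨i, 0, rfl⟩, ?_⟩)
    · have := D.inclSpan_mem_closure h
      simpa [inclSpan, affRoot, root] using this
    · have := D.inclSpan_mem_closure h
      simpa [inclSpan, affRoot, root] using this
  · left
    obtain ⟨n, hn⟩ : ∃ n : ℕ, m = n + 1 := ⟨(m - 1).toNat, by omega⟩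
    rw [hn]
    exact D.affRoot_mem_posRoots i n

lemma coeff_nonneg {a : Vhat V} (ha : a ∈ D.posRoots) : 0 ≤ a.2.1 := by
  refine AddSubmonoid.closure_induction (motive := fun a _ => 0 ≤ a.2.1) ?_ le_rfl
    (fun _ _ _ _ => add_nonneg) ha.2
  rintro _ (rfl | ⟨i, -, rfl⟩) <;> simp [affRoot]

lemma form_pos_of_simple {x : Vhat V} (hx : ∀ a ∈ D.affSimple, 0 < form a x) {a : Vhat V}
    (ha : a ∈ D.posRoots) : 0 < form a x := by
  have h : a = 0 ∨ 0 < form a x := by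
    refine AddSubmonoid.closure_induction (motive := fun a _ => a = 0 ∨ 0 < form a x)
      (fun a ha => Or.inr (hx a ha)) (Or.inl rfl) ?_ ha.2
    rintro a b - - (rfl | ha) (rfl | hb)
    · simp
    · simpa using Or.inr hb
    · simpa using Or.inr ha
    · right
      rw [map_add, LinearMap.add_apply]
      exact add_pos ha hb
  exact h.resolve_left (D.ne_zero_of_mem_affRoots ha.1)

/-- A positive root `α + m c` has `m ≥ 0`, and `(α, v) + m ξ < 0` with `ξ > 0` bounds `m` above for
each of the finitely many `α`. -/
lemma finite_posRoots_neg {x : Vhat V} (hx : x ∈ Vplus V) :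
    {a | a ∈ D.posRoots ∧ form a x < 0}.Finite := by
  have hx' : 0 < x.2.2 := hx
  have := D.finite
  refine (Set.finite_iUnion fun i : ι =>
    (Set.finite_Icc (0 : ℤ) ⌈-⟪D.root i, x.1⟫_ℝ / x.2.2⌉).image (D.affRoot i)).subset ?_
  rintro a ⟨ha, hax⟩
  have h0 := D.coeff_nonneg ha
  obtain ⟨i, m, rfl⟩ := ha.1
  refine Set.mem_iUnion.2 ⟨i, m, ⟨(Int.cast_nonneg_iff (R := ℝ)).1 h0, ?_⟩, rfl⟩
  have h1 : ⟪D.root i, x.1⟫_ℝ + m * x.2.2 < 0 := by simpa [form_apply, affRoot] using hax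
  have h2 : (m : ℝ) ≤ -⟪D.root i, x.1⟫_ℝ / x.2.2 := by
    rw [le_div_iff₀ hx']; linarith
  exact_mod_cast h2.trans (Int.le_ceil _)

/-- The finite parts are proportional, so reducedness forces the ratio to be `1` or `-1`, and `n ≥
0` excludes `-1`. -/
lemma eq_of_eq_nsmul {a b : Vhat V} (ha : a ∈ D.affRoots) (hb : b ∈ D.affRoots) {n : ℕ}
    (h : b = n • a) : b = a := by
  obtain ⟨i, l, rfl⟩ := ha
  obtain ⟨j, m, rfl⟩ := hb
  have h1 : D.root j = (n : ℝ) • D.root i := by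
    have := congrArg Prod.fst h
    simpa [affRoot, Nat.cast_smul_eq_nsmul] using this
  have hP : D.P.root j = (n : ℝ) • D.P.root i := Subtype.ext h1
  have h0 := D.root_ne_zero i
  have hdep : ¬ LinearIndependent ℝ ![D.P.root j, D.P.root i] := by
    intro hl
    have := LinearIndependent.pair_iff.1 hl 1 (-n) (by rw [hP]; module)
    exact one_ne_zero this.1
  have hn : n = 1 := by
    rcases D.reduced.eq_or_eq_neg j i hdep with e | e
    · have e' : D.root j = (1 : ℝ) • D.root i := by rw [one_smul]; exact congrArg Subtype.val e
      exact_mod_cast smul_left_injective ℝ h0 (h1.symm.trans e')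
    · have e' : D.root j = (-1 : ℝ) • D.root i := by rw [neg_one_smul]; exact congrArg Subtype.val e
      have := smul_left_injective ℝ h0 (h1.symm.trans e')
      have h3 : (0 : ℝ) ≤ n := n.cast_nonneg
      linarith
  rw [h, hn, one_smul]

lemma refl_self {a : Vhat V} (ha : a ∈ D.affRoots) : refl a a = -a := by
  have h := D.form_self_ne_zero ha
  rw [refl_apply, map_smul, smul_eq_mul, div_mul_cancel₀ _ h]
  module

lemma refl_refl (a x : Vhat V) : refl a (refl a x) = x := reflFun_involutive a x

lemma s_mul_self (a : D.affRoots) : D.s a * D.s a = 1 :=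
  Subtype.ext (LinearEquiv.ext fun x => refl_refl a.1 x)

lemma s_inv (a : D.affRoots) : (D.s a)⁻¹ = D.s a := inv_eq_of_mul_eq_one_left (D.s_mul_self a)

lemma inv_apply_apply (w : D.extWeyl) (x : Vhat V) : (w⁻¹).1 (w.1 x) = x := by
  simp

lemma form_inv_apply (w : D.extWeyl) (x y : Vhat V) : form x (w⁻¹.1 y) = form (w.1 x) y := by
  rw [← (D.mem_preserves w.2).1, D.apply_inv_apply]

lemma nonempty_and_subset_reg (C : D.Chamber) : C.1.Nonempty ∧ C.1 ⊆ D.reg := by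
  obtain ⟨_, x, hx, rfl⟩ := C
  exact ⟨⟨x, mem_connectedComponentIn hx⟩, connectedComponentIn_subset _ _⟩

lemma chi_eq_zero {a : Vhat V} {C : D.Chamber} {x : Vhat V} (hx : x ∈ C.1)
    (h : 0 < form a x) : D.chi a C = 0 :=
  if_neg fun h' => (h' x hx).not_gt h

lemma finite_chi_ne_zero (C : D.Chamber) : {a | a ∈ D.posRoots ∧ D.chi a C ≠ 0}.Finite := by
  obtain ⟨⟨x, hx⟩, hreg⟩ := D.nonempty_and_subset_reg C
  refine (D.finite_posRoots_neg (hreg hx).1).subset ?_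
  rintro a ⟨ha, hC⟩
  refine ⟨ha, ?_⟩
  by_contra h
  exact hC (D.chi_eq_zero hx (lt_of_le_of_ne (not_lt.1 h) ((hreg hx).2 a ha.1).symm))

/-- Positivity on the positive roots is a convex condition, and every affine root is positive up to
sign. -/
lemma segment_subset_reg {x y : Vhat V} (hx : x ∈ Vplus V) (hy : y ∈ Vplus V)
    (h : ∀ a ∈ D.posRoots, 0 < form a x ∧ 0 < form a y) : segment ℝ x y ⊆ D.reg := by
  rintro _ ⟨s, t, hs, ht, hst, rfl⟩
  have key : ∀ p q : ℝ, 0 < p → 0 < q → 0 < s * p + t * q := fun p q hp hq => by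
    rcases hs.eq_or_lt with rfl | hs
    · rw [zero_add] at hst; simp [hst, hq]
    · positivity
  refine ⟨by exact key _ _ hx hy, fun a ha => ?_⟩
  rcases D.mem_posRoots_or_neg_mem ha with h' | h'
  · have := key _ _ (h a h').1 (h a h').2
    simpa using this.ne'
  · have := key _ _ (h _ h').1 (h _ h').2
    intro h0
    simp only [map_neg, map_add, map_smul, LinearMap.neg_apply, smul_eq_mul] at this h0
    linarith

lemma mem_reg_of_pos {x : Vhat V} (hx : x ∈ Vplus V) (h : ∀ a ∈ D.posRoots, 0 < form a x) :
    x ∈ D.reg :=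
  D.segment_subset_reg hx hx (fun a ha => ⟨h a ha, h a ha⟩) (left_mem_segment ℝ x x)

/-! ### Points with prescribed simple coordinates, and simple reflections -/

variable [FiniteDimensional ℝ V]

/-- Linear independence of the simple roots gives the `V`-component by Riesz representation; the
`d`-coordinate is then free to adjust the value of `-θ + c`. -/
lemma exists_form_simple_eq (c : ι → ℝ) (c₀ : ℝ) : ∃ x : Vhat V,
    (∀ i ∈ D.base.support, form (D.affRoot i 0) x = c i) ∧
      form ((-D.root D.θ, 1, 0) : Vhat V) x = c₀ := by
  have hli : LinearIndependent ℝ fun i : D.base.support => D.root i :=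
    LinearIndependent.map' D.base.linearIndepOn_root D.Vs.subtype (Submodule.ker_subtype _)
  obtain ⟨g, hg⟩ := ((Module.Basis.span hli).constr ℝ fun i => c i).exists_extend
  have hg' : ∀ i ∈ D.base.support, g (D.root i) = c i := fun i hi => by
    have h1 := (Module.Basis.span hli).constr_basis ℝ (fun i => c i) ⟨i, hi⟩
    rw [← hg] at h1
    simpa [Module.Basis.span_apply] using h1
  set v := (InnerProductSpace.toDual ℝ V).symm g.toContinuousLinearMap with hv
  have hv' : ∀ u, ⟪u, v⟫_ℝ = g u := fun u => by
    rw [real_inner_comm, hv, InnerProductSpace.toDual_symm_apply]; rfl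
  refine ⟨(v, 0, c₀ + ⟪D.root D.θ, v⟫_ℝ), fun i hi => ?_, ?_⟩
  · simp [form_apply, affRoot, hv', hg' i hi]
  · simp [form_apply]

lemma exists_mem_Vplus_pos : ∃ x ∈ Vplus V, ∀ a ∈ D.affSimple, 0 < form a x := by
  obtain ⟨x, hx, hx₀⟩ := D.exists_form_simple_eq 1 1
  have hpos : ∀ a ∈ D.affSimple, 0 < form a x := by
    rintro _ (rfl | ⟨i, hi, rfl⟩)
    · rw [hx₀]; exact one_pos
    · simp only []; rw [hx i hi]; exact one_pos
  refine ⟨x, ?_, hpos⟩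
  -- The roots `θ + c` and `-θ + c` are both positive at `x`, and their sum `2 c` pairs with `x` to
  -- twice the `d`-coordinate.
  have h1 := D.form_pos_of_simple hpos (D.affRoot_mem_posRoots D.θ 0)
  obtain ⟨j, hj⟩ := D.exists_neg D.θ
  have h2 := D.form_pos_of_simple hpos (D.affRoot_mem_posRoots j 0)
  simp [form_apply, affRoot, hj] at h1 h2
  change 0 < x.2.2
  linarith

/-- A generic point of the wall of `a` detects multiples of `a` among the nonnegative combinations
of simple roots. -/
lemma exists_wall {a : Vhat V} (ha : a ∈ D.affSimple) :
    ∃ x : Vhat V, form a x = 0 ∧ ∀ b ∈ D.affSimple, b ≠ a → 0 < form b x := by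
  classical
  rcases ha with rfl | ⟨i, hi, rfl⟩
  · obtain ⟨x, hx, hx₀⟩ := D.exists_form_simple_eq 1 0
    refine ⟨x, hx₀, ?_⟩
    rintro _ (rfl | ⟨j, hj, rfl⟩) hb
    · exact absurd rfl hb
    · simp only []; rw [hx j hj]; exact one_pos
  · obtain ⟨x, hx, hx₀⟩ := D.exists_form_simple_eq (fun j => if j = i then 0 else 1) 1
    refine ⟨x, by simp [hx i hi], ?_⟩
    rintro _ (rfl | ⟨j, hj, rfl⟩) hb
    · rw [hx₀]; exact one_pos
    · have hji : j ≠ i := by rintro rfl; exact hb rfl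
      simp only []
      rw [hx j hj, if_neg hji]
      exact one_pos

lemma neg_notMem_posRoots {a : Vhat V} (ha : a ∈ D.posRoots) : -a ∉ D.posRoots := fun h => by
  obtain ⟨x, -, hx⟩ := D.exists_mem_Vplus_pos
  have h1 := D.form_pos_of_simple hx ha
  have h2 := D.form_pos_of_simple hx h
  rw [map_neg, LinearMap.neg_apply] at h2
  linarith

/-- A simple reflection permutes the positive roots different from the simple root. -/
lemma refl_simple_mem_posRoots {a b : Vhat V} (ha : a ∈ D.affSimple) (hb : b ∈ D.posRoots)
    (hba : b ≠ a) : refl a b ∈ D.posRoots := by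
  have ha' := D.simple_subset ha
  refine (D.mem_posRoots_or_neg_mem
    (((D.mem_preserves (D.refl_mem ha')).2.2 b).2 hb.1)).resolve_right fun hneg => hba ?_
  obtain ⟨x, hx, hpos⟩ := D.exists_wall ha
  -- As `(a, x) = 0`, the roots `b` and `s_a b` take the same value at `x`. If `-s_a b` were
  -- positive, this value would be zero, making `b` a multiple of `a`.
  have key : ∀ c ∈ AddSubmonoid.closure D.affSimple,
      0 ≤ form c x ∧ (form c x = 0 → ∃ n : ℕ, c = n • a) := by
    intro c hc
    induction hc using AddSubmonoid.closure_induction with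
    | mem c hc =>
      by_cases hca : c = a
      · exact ⟨by rw [hca, hx], fun _ => ⟨1, by simp [hca]⟩⟩
      · exact ⟨(hpos c hc hca).le, fun h => absurd h (hpos c hc hca).ne'⟩
    | zero => exact ⟨by simp, fun _ => ⟨0, by simp⟩⟩
    | add c d _ _ hc hd =>
      rw [map_add, LinearMap.add_apply]
      refine ⟨add_nonneg hc.1 hd.1, fun h => ?_⟩
      obtain ⟨m, hm⟩ := hc.2 (by linarith [hc.1, hd.1])
      obtain ⟨n, hn⟩ := hd.2 (by linarith [hc.1, hd.1])
      exact ⟨m + n, by rw [hm, hn, add_smul]⟩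
  have h1 := key b hb.2
  have h2 := (key _ hneg.2).1
  rw [map_neg, LinearMap.neg_apply, refl_apply, map_sub, map_smul, LinearMap.sub_apply,
    LinearMap.smul_apply, hx, smul_zero, sub_zero] at h2
  obtain ⟨n, hn⟩ := h1.2 (by linarith [h1.1])
  exact D.eq_of_eq_nsmul ha' hb.1 hn

lemma refl_simple_ne {a b : Vhat V} (ha : a ∈ D.affSimple) (hb : b ∈ D.posRoots) :
    refl a b ≠ a := fun h => by
  have h1 : -a = b := by rw [← refl_refl a b, h, D.refl_self (D.simple_subset ha)]
  exact D.neg_notMem_posRoots (D.simple_subset_posRoots ha) (h1.symm ▸ hb)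

lemma IsOmega.inv {D : AffineDatum ι V} {w : D.extWeyl} (hw : D.IsOmega w) {a : Vhat V}
    (ha : a ∈ D.posRoots) : w⁻¹.1 a ∈ D.posRoots := by
  refine (D.mem_posRoots_or_neg_mem
    (((D.mem_preserves w⁻¹.2).2.2 a).2 ha.1)).resolve_right fun hneg => ?_
  have := hw _ hneg
  rw [map_neg, D.apply_inv_apply] at this
  exact D.neg_notMem_posRoots ha this

/-! ### Chambers -/

lemma chi_eq_one {a : Vhat V} (ha : a ∈ D.affRoots) {C : D.Chamber} {x : Vhat V} (hx : x ∈ C.1)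
    (h : form a x < 0) : D.chi a C = 1 := by
  rw [D.chi_eq a ha C x hx, Set.indicator_of_mem (by exact h), Pi.one_apply]

lemma chi_neg {a : Vhat V} (ha : a ∈ D.affRoots) (C : D.Chamber) :
    D.chi (-a) C = 1 - D.chi a C := by
  obtain ⟨⟨x, hx⟩, hreg⟩ := D.nonempty_and_subset_reg C
  rcases lt_or_gt_of_ne ((hreg hx).2 a ha) with h | h
  · rw [D.chi_eq_one ha hx h, D.chi_eq_zero hx (by simpa using h), sub_self]
  · rw [D.chi_eq_zero hx h, D.chi_eq_one (D.neg_mem_affRoots ha) hx (by simpa using h), sub_zero]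

lemma chi_chamberMap (w : D.extWeyl) (a : Vhat V) (C : D.Chamber) :
    D.chi a (D.chamberMap w C) = D.chi (w⁻¹.1 a) C := by
  have h : (∀ x ∈ (D.chamberMap w C).1, form a x < 0) ↔ ∀ x ∈ C.1, form (w⁻¹.1 a) x < 0 := by
    simp only [chamberMap, Set.forall_mem_image]
    refine forall₂_congr fun x _ => ?_
    rw [form_comm (w⁻¹.1 a), D.form_inv_apply, form_comm]
  classical
  exact if_congr h rfl rfl

lemma chamberMap_one (C : D.Chamber) : D.chamberMap 1 C = C := Subtype.ext (Set.image_id _)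

lemma chamberMap_mul (v w : D.extWeyl) (C : D.Chamber) :
    D.chamberMap (v * w) C = D.chamberMap v (D.chamberMap w C) :=
  Subtype.ext (Set.image_comp v.1 w.1 C.1)

/-- A point of the fundamental chamber. -/
def fundPoint : Vhat V := D.exists_mem_Vplus_pos.choose

lemma fundPoint_mem_Vplus : D.fundPoint ∈ Vplus V := D.exists_mem_Vplus_pos.choose_spec.1

lemma form_fundPoint_pos {a : Vhat V} (ha : a ∈ D.posRoots) : 0 < form a D.fundPoint :=
  D.form_pos_of_simple D.exists_mem_Vplus_pos.choose_spec.2 ha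

lemma fundPoint_mem_reg : D.fundPoint ∈ D.reg :=
  D.mem_reg_of_pos D.fundPoint_mem_Vplus fun _ => D.form_fundPoint_pos

/-- The fundamental chamber. -/
def fundChamber : D.Chamber := ⟨_, D.fundPoint, D.fundPoint_mem_reg, rfl⟩

lemma fundPoint_mem_fundChamber : D.fundPoint ∈ D.fundChamber.1 :=
  mem_connectedComponentIn D.fundPoint_mem_reg

lemma chi_fundChamber {a : Vhat V} (ha : a ∈ D.posRoots) : D.chi a D.fundChamber = 0 :=
  D.chi_eq_zero D.fundPoint_mem_fundChamber (D.form_fundPoint_pos ha)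

/-- The segment from `x` to the base point stays regular, so both lie in one component. -/
lemma eq_fundChamber {C : D.Chamber} {x : Vhat V} (hx : x ∈ C.1)
    (h : ∀ a ∈ D.affSimple, 0 < form a x) : C = D.fundChamber := by
  have hxr := (D.nonempty_and_subset_reg C).2 hx
  have hseg := D.segment_subset_reg hxr.1 D.fundPoint_mem_Vplus fun a ha =>
    ⟨D.form_pos_of_simple h ha, D.form_fundPoint_pos ha⟩
  have hmem := (convex_segment x D.fundPoint).isPreconnected.subset_connectedComponentIn
    (left_mem_segment ℝ _ _) hseg (right_mem_segment ℝ _ _)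
  obtain ⟨_, y, hy, rfl⟩ := C
  refine Subtype.ext ?_
  change connectedComponentIn D.reg y = connectedComponentIn D.reg D.fundPoint
  rw [connectedComponentIn_eq hx, connectedComponentIn_eq hmem]

/-- A property of chambers holds for all of them if it holds for the fundamental chamber and is
stable under simple reflections. -/
lemma chamber_induction {p : D.Chamber → Prop} (h₀ : p D.fundChamber)
    (hs : ∀ (a : D.affRoots), a.1 ∈ D.affSimple → ∀ C, p (D.chamberMap (D.s a) C) → p C)
    (C : D.Chamber) : p C := by
  -- The induction is on the number of positive roots negative on `C`, the length of a gallery to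
  -- the fundamental chamber.
  induction hn : {a | a ∈ D.posRoots ∧ D.chi a C ≠ 0}.ncard using Nat.strong_induction_on
    generalizing C with
  | _ n ih =>
  by_cases h : ∃ a ∈ D.affSimple, D.chi a C ≠ 0
  · obtain ⟨a, ha, haC⟩ := h
    have ha' := D.simple_subset ha
    refine hs ⟨a, ha'⟩ ha C (ih _ ?_ _ rfl)
    rw [← hn]
    set S := {b | b ∈ D.posRoots ∧ D.chi b C ≠ 0}
    have hfin : S.Finite := D.finite_chi_ne_zero C
    -- Reflecting in a simple root `a` negative on `C` removes `a` from this set and only moves the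
    -- other roots by `s_a`, so the count drops.
    have hmaps : Set.MapsTo (refl a)
        {b | b ∈ D.posRoots ∧ D.chi b (D.chamberMap (D.s ⟨a, ha'⟩) C) ≠ 0} (S \ {a}) := by
      rintro b ⟨hb, hbC⟩
      rw [chi_chamberMap, s_inv] at hbC
      change D.chi (refl a b) C ≠ 0 at hbC
      have hba : b ≠ a := by
        rintro rfl
        obtain ⟨⟨x, hx⟩, hreg⟩ := D.nonempty_and_subset_reg C
        rw [D.refl_self ha', D.chi_neg ha'] at hbC
        rcases lt_or_gt_of_ne ((hreg hx).2 _ ha') with h | h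
        · exact hbC (by rw [D.chi_eq_one ha' hx h, sub_self])
        · exact haC (D.chi_eq_zero hx h)
      exact ⟨⟨D.refl_simple_mem_posRoots ha hb hba, hbC⟩, D.refl_simple_ne ha hb⟩
    refine (Set.ncard_le_ncard_of_injOn _ hmaps (refl a).injective.injOn hfin.sdiff).trans_lt ?_
    exact Set.ncard_sdiff_singleton_lt_of_mem ⟨D.simple_subset_posRoots ha, haC⟩ hfin
  · push Not at h
    obtain ⟨⟨x, hx⟩, hreg⟩ := D.nonempty_and_subset_reg C
    have : C = D.fundChamber := D.eq_fundChamber hx fun a ha => by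
      have ha' := D.simple_subset ha
      refine (lt_or_gt_of_ne ((hreg hx).2 a ha')).resolve_left fun hlt => ?_
      exact one_ne_zero ((D.chi_eq_one ha' hx hlt).symm.trans (h a ha))
    rwa [this]

/-- A root is positive exactly when it is positive on the fundamental chamber, so an element fixing
that chamber cannot make a positive root negative. -/
lemma isOmega_of_chamberMap_eq {w : D.extWeyl} (h : D.chamberMap w D.fundChamber = D.fundChamber) :
    D.IsOmega w := by
  intro a ha
  have hw := ((D.mem_preserves w.2).2.2 a).2 ha.1
  refine (D.mem_posRoots_or_neg_mem hw).resolve_right fun hneg => ?_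
  have h1 := D.chi_chamberMap w (w.1 a) D.fundChamber
  rw [D.inv_apply_apply, D.chi_fundChamber ha, h] at h1
  have h2 := D.chi_fundChamber hneg
  rw [D.chi_neg hw, h1, sub_zero] at h2
  exact one_ne_zero h2

/-- The extended affine Weyl group is generated by the simple reflections and the elements that
preserve the positive roots. -/
lemma generators_induction {p : D.extWeyl → Prop} (hω : ∀ w, D.IsOmega w → p w)
    (hs : ∀ a : D.affRoots, a.1 ∈ D.affSimple → ∀ w, p w → p (D.s a * w)) (w : D.extWeyl) :
    p w := by
  refine D.chamber_induction (p := fun C => ∀ w, D.chamberMap w D.fundChamber = C → p w)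
    (fun w h => hω w (D.isOmega_of_chamberMap_eq h)) (fun a ha C ih w h => ?_) _ w rfl
  have := hs a ha _ (ih (D.s a * w) (by rw [chamberMap_mul, h]))
  rwa [← mul_assoc, s_mul_self, one_mul] at this

end Roots

end AffineDatum

/-! ### Real analytic functions on `Vplus V` -/

section AnalyticFunctions

variable {V : Type*} [NormedAddCommGroup V] [InnerProductSpace ℝ V]

lemma Analytic.ext {f g : Analytic V} (h : ∀ x ∈ Vplus V, f.1 x = g.1 x) : f = g := by
  refine Subtype.ext (funext fun x => ?_)
  by_cases hx : x ∈ Vplus V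
  · exact h x hx
  · rw [f.2.2 x hx, g.2.2 x hx]

lemma Analytic.analyticAt (f : Analytic V) {x : Vhat V} (hx : x ∈ Vplus V) :
    AnalyticAt ℝ f.1 x := f.2.1 x hx

lemma partialDeriv_apply (v : Vhat V) (f : Analytic V) {x : Vhat V} (hx : x ∈ Vplus V) :
    (partialDeriv v f).1 x = fderiv ℝ f.1 x v :=
  (if_pos hx).trans (f.analyticAt hx).differentiableAt.lineDeriv_eq_fderiv

lemma partialDeriv_add (u v : Vhat V) :
    partialDeriv (u + v) = partialDeriv u + partialDeriv v :=
  LinearMap.ext fun f => Analytic.ext fun x hx => by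
    rw [partialDeriv_apply _ _ hx, map_add, ← partialDeriv_apply _ _ hx,
      ← partialDeriv_apply _ _ hx]
    rfl

lemma partialDeriv_smul (r : ℝ) (v : Vhat V) :
    partialDeriv (r • v) = (r : ℂ) • partialDeriv v :=
  LinearMap.ext fun f => Analytic.ext fun x hx => by
    rw [partialDeriv_apply _ _ hx, map_smul, ← partialDeriv_apply _ _ hx]
    rfl

lemma partialDeriv_comm (u v : Vhat V) :
    partialDeriv u ∘ₗ partialDeriv v = partialDeriv v ∘ₗ partialDeriv u :=
  LinearMap.ext fun f => Analytic.ext fun x hx => by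
    have key : ∀ u v : Vhat V, (partialDeriv u (partialDeriv v f)).1 x =
        fderiv ℝ (fderiv ℝ f.1) x u v := fun u v => by
      rw [partialDeriv_apply _ _ hx]
      have hev : (partialDeriv v f).1 =ᶠ[nhds x] fun y => fderiv ℝ f.1 y v := by
        filter_upwards [isOpen_Vplus.mem_nhds hx] with y hy using partialDeriv_apply v f hy
      rw [hev.fderiv_eq, fderiv_clm_apply (f.analyticAt hx).fderiv.differentiableAt
        (differentiableAt_const v)]
      simp
    have hsymm : IsSymmSndFDerivAt ℝ f.1 x :=
      (f.analyticAt hx).contDiffAt.isSymmSndFDerivAt (n := 2) (by simp)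
    exact (key u v).trans ((hsymm.eq u v).trans (key v u).symm)

open Classical in
/-- The exponential of a linear functional. -/
def expAnalytic (l : Module.Dual ℂ (Hhat V)) [FiniteDimensional ℝ V] : Analytic V :=
  ⟨fun x => if x ∈ Vplus V then Complex.exp (l ((1 : ℂ) ⊗ₜ x)) else 0, by
    refine ⟨?_, fun x hx => if_neg hx⟩
    have h : AnalyticOnNhd ℝ (fun x : Vhat V => Complex.exp (l ((1 : ℂ) ⊗ₜ x))) (Vplus V) :=
      fun x _ => (analyticAt_cexp.restrictScalars (𝕜 := ℝ)).comp ((LinearMap.toContinuousLinearMap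
        (l.restrictScalars ℝ ∘ₗ TensorProduct.mk ℝ ℂ (Vhat V) 1)).analyticAt x)
    exact h.congr isOpen_Vplus fun x hx => (if_pos hx).symm⟩

variable [FiniteDimensional ℝ V]

lemma expAnalytic_apply (l : Module.Dual ℂ (Hhat V)) {x : Vhat V} (hx : x ∈ Vplus V) :
    (expAnalytic l).1 x = Complex.exp (l ((1 : ℂ) ⊗ₜ x)) := if_pos hx

lemma expAnalytic_ne_zero (l : Module.Dual ℂ (Hhat V)) : expAnalytic l ≠ 0 := fun h => by
  have hx : ((0, 0, 1) : Vhat V) ∈ Vplus V := one_pos (α := ℝ)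
  have h1 := expAnalytic_apply l hx
  rw [h] at h1
  exact Complex.exp_ne_zero _ h1.symm

lemma partialDeriv_expAnalytic (l : Module.Dual ℂ (Hhat V)) (v : Vhat V) :
    partialDeriv v (expAnalytic l) = l ((1 : ℂ) ⊗ₜ v) • expAnalytic l :=
  Analytic.ext fun x hx => by
    set L : Vhat V →L[ℝ] ℂ := LinearMap.toContinuousLinearMap
      (l.restrictScalars ℝ ∘ₗ TensorProduct.mk ℝ ℂ (Vhat V) 1) with hL
    have hev : (expAnalytic l).1 =ᶠ[nhds x] fun y => Complex.exp (L y) := by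
      filter_upwards [isOpen_Vplus.mem_nhds hx] with y hy using expAnalytic_apply l hy
    rw [partialDeriv_apply _ _ hx, hev.fderiv_eq, (L.hasFDerivAt.cexp).fderiv]
    change Complex.exp (L x) * L v = L v * (expAnalytic l).1 x
    rw [expAnalytic_apply l hx, mul_comm]
    rfl

namespace AffineDatum

variable {ι : Type*} (D : AffineDatum ι V)

lemma pull_one : D.pull 1 = LinearMap.id := rfl

lemma pull_mul (w w' : D.extWeyl) : D.pull (w * w') = D.pull w ∘ₗ D.pull w' :=
  LinearMap.ext fun f => Analytic.ext fun x _ => by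
    change f.1 (((w * w')⁻¹).1 x) = f.1 ((w'⁻¹).1 ((w⁻¹).1 x))
    rw [mul_inv_rev]
    rfl

lemma pull_partialDeriv (w : D.extWeyl) (v : Vhat V) :
    D.pull w ∘ₗ partialDeriv v = partialDeriv (w.1 v) ∘ₗ D.pull w :=
  LinearMap.ext fun f => Analytic.ext fun x hx => by
    have hx' := (D.mem_Vplus_iff w⁻¹ x).2 hx
    rw [LinearMap.comp_apply, LinearMap.comp_apply, partialDeriv_apply _ _ hx]
    change (partialDeriv v f).1 (w⁻¹.1 x) = _
    rw [partialDeriv_apply _ _ hx']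
    have h : HasFDerivAt (D.pull w f).1 ((fderiv ℝ f.1 (w⁻¹.1 x)).comp
        w⁻¹.1.toContinuousLinearEquiv.toContinuousLinearMap) x :=
      (f.analyticAt hx').differentiableAt.hasFDerivAt.comp x
        w⁻¹.1.toContinuousLinearEquiv.toContinuousLinearMap.hasFDerivAt
    rw [h.fderiv]
    change _ = fderiv ℝ f.1 (w⁻¹.1 x) (w⁻¹.1 (w.1 v))
    rw [D.inv_apply_apply]

lemma pull_expAnalytic (w : D.extWeyl) (l : Module.Dual ℂ (Hhat V)) :
    D.pull w (expAnalytic l) = expAnalytic (l ∘ₗ w⁻¹.1.toLinearMap.baseChange ℂ) :=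
  Analytic.ext fun x hx => by
    rw [expAnalytic_apply _ hx]
    change (expAnalytic l).1 (w⁻¹.1 x) = _
    rw [expAnalytic_apply _ ((D.mem_Vplus_iff w⁻¹ x).2 hx)]
    simp

end AffineDatum

end AnalyticFunctions

/-! ### Affine Dunkl operators -/

namespace AffineDatum

section Dunkl

variable {ι V : Type*} [NormedAddCommGroup V] [InnerProductSpace ℝ V] (D : AffineDatum ι V)

/-- The action of the extended affine Weyl group on the affine roots. -/
def rootMap (w : D.extWeyl) (a : D.affRoots) : D.affRoots :=
  ⟨w.1 a.1, ((D.mem_preserves w.2).2.2 a.1).2 a.2⟩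

lemma mul_s (w : D.extWeyl) (a : D.affRoots) : w * D.s a = D.s (D.rootMap w a) * w := by
  refine Subtype.ext (LinearEquiv.ext fun x => ?_)
  change w.1 (refl a.1 x) = refl (w.1 a.1) (w.1 x)
  simp only [refl_apply, map_sub, map_smul, (D.mem_preserves w.2).1]

/-- A positive root, as an affine root. -/
def posRoot (a : D.posRoots) : D.affRoots := ⟨a.1, a.2.1⟩

/-- The permutation of the positive roots that fixes the simple root `a` and agrees with `s_a` on
the other positive roots. -/
lemma exists_perm_simple [FiniteDimensional ℝ V] {a : Vhat V} (ha : a ∈ D.affSimple) :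
    ∃ σ : Equiv.Perm D.posRoots, ∀ b,
      (b.1 = a → (σ b).1 = a) ∧ (b.1 ≠ a → (σ b).1 = refl a b.1) := by
  classical
  let f : D.posRoots → D.posRoots := fun b =>
    if h : b.1 = a then b else ⟨refl a b.1, D.refl_simple_mem_posRoots ha b.2 h⟩
  have hf : ∀ b, (b.1 = a → (f b).1 = a) ∧ (b.1 ≠ a → (f b).1 = refl a b.1) := fun b =>
    ⟨fun h => by simp only [f, dif_pos h]; exact h, fun h => by simp only [f, dif_neg h]⟩
  have hinv : Function.Involutive f := fun b => by
    refine Subtype.ext ?_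
    by_cases h : b.1 = a
    · rw [(hf _).1 ((hf b).1 h), h]
    · have h1 := (hf b).2 h
      rw [(hf (f b)).2 (by rw [h1]; exact D.refl_simple_ne ha b.2), h1, refl_refl]
  exact ⟨hinv.toPerm, hf⟩

lemma exists_perm_isOmega [FiniteDimensional ℝ V] {w : D.extWeyl} (hw : D.IsOmega w) :
    ∃ σ : Equiv.Perm D.posRoots, ∀ b, (σ b).1 = w.1 b.1 :=
  ⟨{ toFun := fun b => ⟨w.1 b.1, hw _ b.2⟩
     invFun := fun b => ⟨w⁻¹.1 b.1, hw.inv b.2⟩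
     left_inv := fun b => Subtype.ext (D.inv_apply_apply w b.1)
     right_inv := fun b => Subtype.ext (D.apply_inv_apply w b.1) }, fun _ => rfl⟩

lemma finite_posRoot_chi (C : D.Chamber) : {a : D.posRoots | D.chi a.1 C ≠ 0}.Finite :=
  ((D.finite_chi_ne_zero C).preimage Subtype.val_injective.injOn).subset fun a ha => ⟨a.2, ha⟩

variable {M : Type*} [AddCommGroup M] [Module ℂ M]

lemma deriv_apply (v : Vhat V) (f : D.FM M) (C : D.Chamber) :
    D.deriv M v f C = LinearMap.rTensor M (partialDeriv v) (f C) := rfl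

variable [FiniteDimensional ℝ V]
  (k : D.affRoots → ℂ) (π : Representation ℂ D.extWeyl M)

lemma act_apply (w : D.extWeyl) (f : D.FM M) (C : D.Chamber) :
    D.act π w f C = TensorProduct.map (D.pull w) (π w) (f (D.chamberMap w⁻¹ C)) := rfl

lemma act_one : D.act π 1 = 1 := by
  refine LinearMap.ext fun f => funext fun C => ?_
  rw [act_apply, inv_one, chamberMap_one, map_one, pull_one, Module.End.one_eq_id,
    TensorProduct.map_id]
  rfl

lemma act_mul (w w' : D.extWeyl) : D.act π (w * w') = D.act π w * D.act π w' := by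
  refine LinearMap.ext fun f => funext fun C => ?_
  rw [Module.End.mul_apply, act_apply, act_apply, act_apply, mul_inv_rev, chamberMap_mul, map_mul,
    pull_mul, Module.End.mul_eq_comp, TensorProduct.map_comp]
  rfl

lemma act_deriv (w : D.extWeyl) (v : Vhat V) (f : D.FM M) :
    D.act π w (D.deriv M v f) = D.deriv M (w.1 v) (D.act π w f) := by
  refine funext fun C => ?_
  rw [act_apply, deriv_apply, deriv_apply, act_apply]
  generalize f (D.chamberMap w⁻¹ C) = t
  rw [LinearMap.rTensor, LinearMap.rTensor, ← LinearMap.comp_apply, ← LinearMap.comp_apply,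
    ← TensorProduct.map_comp, ← TensorProduct.map_comp, pull_partialDeriv]
  rfl

/-- The contribution of an affine root to the affine Dunkl operator. -/
def dunklTerm (v : Vhat V) (f : D.FM M) (C : D.Chamber) (a : D.affRoots) : Analytic V ⊗[ℂ] M :=
  (k a * (form a.1 v : ℝ) * D.chi a.1 C) • D.act π (D.s a) f C

lemma finite_support_dunklTerm (v : Vhat V) (f : D.FM M) (C : D.Chamber) :
    (Function.support fun a => D.dunklTerm k π v f C (D.posRoot a)).Finite :=
  (D.finite_posRoot_chi C).subset fun a ha h => ha (by simp [dunklTerm, posRoot, h])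

lemma dunklSum_apply (v : Vhat V) (f : D.FM M) (C : D.Chamber) :
    D.dunklSum k π v f C = ∑ᶠ a : D.posRoots, D.dunklTerm k π v f C (D.posRoot a) := by
  -- A `finsum` with infinite support is zero by convention, so finiteness must be known for the
  -- operators themselves before evaluation at `f` can pass inside.
  have hfin : (Function.support fun a : D.posRoots =>
      (k ⟨a.1, a.2.1⟩ * (form a.1 v : ℝ)) • ((LinearMap.proj C : D.FM M →ₗ[ℂ] _) ∘ₗ
        D.chiOp M a.1 ∘ₗ D.act π (D.s ⟨a.1, a.2.1⟩))).Finite := by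
    refine (D.finite_posRoot_chi C).subset fun a ha h => ha (LinearMap.ext fun g => ?_)
    simp [chiOp, h]
  have h := (LinearMap.applyₗ f).toAddMonoidHom.map_finsum hfin
  refine h.trans (finsum_congr fun a => ?_)
  exact smul_smul (k ⟨a.1, a.2.1⟩ * (form a.1 v : ℝ) : ℂ) (D.chi a.1 C)
    (D.act π (D.s ⟨a.1, a.2.1⟩) f C)

lemma dunkl_apply (v : Vhat V) (f : D.FM M) (C : D.Chamber) :
    D.dunkl k π v f C = LinearMap.rTensor M (partialDeriv v) (f C) -
      ∑ᶠ a : D.posRoots, D.dunklTerm k π v f C (D.posRoot a) := by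
  rw [← dunklSum_apply]
  rfl

lemma dunkl_fundChamber (v : Vhat V) (f : D.FM M) :
    D.dunkl k π v f D.fundChamber = LinearMap.rTensor M (partialDeriv v) (f D.fundChamber) := by
  rw [dunkl_apply, finsum_eq_zero_of_forall_eq_zero, sub_zero]
  intro a
  simp [dunklTerm, posRoot, D.chi_fundChamber a.2]

lemma dunkl_add (u v : Vhat V) : D.dunkl k π (u + v) = D.dunkl k π u + D.dunkl k π v := by
  refine LinearMap.ext fun f => funext fun C => ?_
  rw [LinearMap.add_apply, Pi.add_apply, dunkl_apply, dunkl_apply, dunkl_apply, partialDeriv_add,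
    LinearMap.rTensor_add, LinearMap.add_apply, sub_add_sub_comm,
    ← finsum_add_distrib (D.finite_support_dunklTerm k π u f C)
      (D.finite_support_dunklTerm k π v f C)]
  congr 1
  refine finsum_congr fun a => ?_
  simp only [dunklTerm, map_add, Complex.ofReal_add]
  module

lemma dunkl_smul (r : ℝ) (v : Vhat V) : D.dunkl k π (r • v) = (r : ℂ) • D.dunkl k π v := by
  refine LinearMap.ext fun f => funext fun C => ?_
  rw [LinearMap.smul_apply, Pi.smul_apply, dunkl_apply, dunkl_apply, partialDeriv_smul,
    LinearMap.rTensor_smul, LinearMap.smul_apply, smul_sub,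
    smul_finsum' (r : ℂ) (D.finite_support_dunklTerm k π v f C)]
  congr 1
  refine finsum_congr fun a => ?_
  simp only [dunklTerm, map_smul, smul_smul, smul_eq_mul, Complex.ofReal_mul]
  congr 1
  ring

/-! ### Cross relations and commutativity of the Dunkl operators -/

variable {k}

lemma act_dunklTerm (hk : D.IsMultiplicity k) (w : D.extWeyl) (v : Vhat V) (f : D.FM M)
    (C : D.Chamber) (a : D.affRoots) :
    TensorProduct.map (D.pull w) (π w) (D.dunklTerm k π v f (D.chamberMap w⁻¹ C) a) =
      D.dunklTerm k π (w.1 v) (D.act π w f) C (D.rootMap w a) := by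
  rw [dunklTerm, dunklTerm, map_smul, ← act_apply, ← Module.End.mul_apply,
    ← Module.End.mul_apply, ← act_mul, ← act_mul, mul_s, chi_chamberMap, inv_inv]
  congr 3
  rw [hk w.1 w.2 a (D.rootMap w a) rfl]
  simp only [rootMap, (D.mem_preserves w.2).1]

/-- Conjugation by an arbitrary `w` moves the index set of the Dunkl sum to `w` of the positive
roots; the cross relations compare this set with the original one. -/
lemma act_dunkl_apply (hk : D.IsMultiplicity k) (w : D.extWeyl) (v : Vhat V) (f : D.FM M)
    (C : D.Chamber) :
    D.act π w (D.dunkl k π v f) C =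
      LinearMap.rTensor M (partialDeriv (w.1 v)) (D.act π w f C) -
        ∑ᶠ a : D.posRoots, D.dunklTerm k π (w.1 v) (D.act π w f) C (D.rootMap w (D.posRoot a)) := by
  rw [← deriv_apply, ← act_deriv, act_apply, dunkl_apply, map_sub, act_apply, deriv_apply]
  congr 1
  have h := (TensorProduct.map (D.pull w) (π w)).toAddMonoidHom.map_finsum
    (D.finite_support_dunklTerm k π v f (D.chamberMap w⁻¹ C))
  exact h.trans (finsum_congr fun a => D.act_dunklTerm π hk w v f C _)

lemma act_isOmega_mul_dunkl (hk : D.IsMultiplicity k) {w : D.extWeyl} (hw : D.IsOmega w)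
    (v : Vhat V) : D.act π w * D.dunkl k π v = D.dunkl k π (w.1 v) * D.act π w := by
  refine LinearMap.ext fun f => funext fun C => ?_
  rw [Module.End.mul_apply, Module.End.mul_apply, act_dunkl_apply D π hk, dunkl_apply]
  obtain ⟨σ, hσ⟩ := D.exists_perm_isOmega hw
  congr 1
  refine (finsum_congr fun a => ?_).trans (finsum_comp_equiv σ)
  congr 1
  exact Subtype.ext (hσ a).symm

lemma act_simple_mul_dunkl (hk : D.IsMultiplicity k) (a : D.affRoots) (ha : a.1 ∈ D.affSimple)
    (v : Vhat V) :
    D.act π (D.s a) * D.dunkl k π v =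
      D.dunkl k π (refl a.1 v) * D.act π (D.s a) -
        algebraMap ℂ (Module.End ℂ (D.FM M)) (k a * (form a.1 v : ℝ)) := by
  classical
  refine LinearMap.ext fun f => funext fun C => ?_
  rw [LinearMap.sub_apply, Pi.sub_apply, Module.End.mul_apply, Module.End.mul_apply,
    act_dunkl_apply D π hk, dunkl_apply, sub_sub]
  obtain ⟨σ, hσ⟩ := D.exists_perm_simple ha
  change LinearMap.rTensor M (partialDeriv (refl a.1 v)) (D.act π (D.s a) f C) -
    ∑ᶠ b : D.posRoots, D.dunklTerm k π (refl a.1 v) (D.act π (D.s a) f) C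
      (D.rootMap (D.s a) (D.posRoot b)) = _
  congr 1
  set g := D.act π (D.s a) f with hg
  set G := D.dunklTerm k π (refl a.1 v) g C with hG
  let a' : D.posRoots := ⟨a.1, D.simple_subset_posRoots ha⟩
  -- Off `a`, the sum is merely reindexed by `σ`. At `a`, the term of `-a` exceeds that of `a` by
  -- `k_a (a, v) f_C`, from `χ_{-a} = 1 - χ_a` and `s_a g = f`.
  have hterm : ∀ b : D.posRoots, G (D.rootMap (D.s a) (D.posRoot b)) =
      G (D.posRoot (σ b)) + if b = a' then (k a * (form a.1 v : ℝ)) • f C else 0 := by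
    intro b
    by_cases hb : b = a'
    · rw [if_pos hb]
      have h1 : D.posRoot (σ b) = a := Subtype.ext ((hσ b).1 (congrArg Subtype.val hb))
      have h2 : D.posRoot b = a := Subtype.ext (show b.1 = a'.1 from congrArg Subtype.val hb)
      have h3 : D.s (D.rootMap (D.s a) a) = D.s a :=
        mul_right_cancel (D.mul_s (D.s a) a).symm
      have h4 : D.act π (D.s a) g = f := by
        rw [hg, ← Module.End.mul_apply, ← act_mul, s_mul_self, act_one]; rfl
      have h5 : (D.rootMap (D.s a) a).1 = -a.1 := D.refl_self a.2
      have h6 : form a.1 (refl a.1 v) = -form a.1 v := by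
        rw [← form_refl a.1, refl_refl, D.refl_self a.2, map_neg, LinearMap.neg_apply]
      have h7 : k (D.rootMap (D.s a) a) = k a := hk _ (D.s a).2 _ _ rfl
      rw [h1, h2, hG, dunklTerm, dunklTerm, h3, h4, h5, h7, D.chi_neg a.2, map_neg,
        LinearMap.neg_apply, h6, ← add_smul]
      congr 1
      push_cast
      ring
    · rw [if_neg hb, add_zero]
      congr 1
      exact Subtype.ext ((hσ b).2 fun h => hb (Subtype.ext h)).symm
  rw [finsum_congr hterm, finsum_add_distrib, finsum_comp_equiv σ (f := fun b => G (D.posRoot b)),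
    finsum_eq_single _ a' fun b hb => if_neg hb, if_pos rfl]
  · rfl
  · exact (D.finite_support_dunklTerm k π (refl a.1 v) g C).preimage σ.injective.injOn
  · refine (Set.finite_singleton a').subset fun b hb => ?_
    by_contra h
    exact hb (if_neg h)

/-- The scalar corrections produce first-order terms. Expanding `D_{s_a x} = D_x - (2 (a, x) / (a,
a)) D_a`, they cancel because the coefficient of `D_a` is symmetric in `u` and `v`. -/
lemma act_simple_mul_commutator (hk : D.IsMultiplicity k) (a : D.affRoots)
    (ha : a.1 ∈ D.affSimple) (u v : Vhat V) :
    D.act π (D.s a) * (D.dunkl k π u * D.dunkl k π v - D.dunkl k π v * D.dunkl k π u) =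
      (D.dunkl k π (refl a.1 u) * D.dunkl k π (refl a.1 v) -
        D.dunkl k π (refl a.1 v) * D.dunkl k π (refl a.1 u)) * D.act π (D.s a) := by
  have hu := D.act_simple_mul_dunkl π hk a ha u
  have hv := D.act_simple_mul_dunkl π hk a ha v
  have hrefl : ∀ x : Vhat V, D.dunkl k π (refl a.1 x) = D.dunkl k π x -
      ((2 / form a.1 a.1 * form a.1 x : ℝ) : ℂ) • D.dunkl k π a.1 := by
    intro x
    have e : refl a.1 x = x + (-(2 / form a.1 a.1 * form a.1 x)) • a.1 := by
      rw [refl_apply, map_smul, form_comm x, smul_eq_mul]; module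
    rw [e, dunkl_add, dunkl_smul]
    push_cast
    module
  rw [Algebra.algebraMap_eq_smul_one] at hu hv
  rw [mul_sub, ← mul_assoc, ← mul_assoc, hu, hv, sub_mul, sub_mul, mul_assoc, mul_assoc, hu, hv,
    mul_sub, mul_sub, sub_mul, mul_assoc, mul_assoc]
  have : ∀ X Y P Q R S : Module.End ℂ (D.FM M), P + R = S + Q →
      (X - P - R) - (Y - S - Q) = X - Y := fun X Y P Q R S h => by
    have h' : P = S + Q - R := eq_sub_of_add_eq h
    rw [h']; abel
  refine this _ _ _ _ _ _ ?_
  rw [hrefl u, hrefl v]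
  simp only [mul_smul_comm, smul_mul_assoc, one_mul, mul_one, smul_sub, smul_smul,
    Complex.ofReal_mul]
  module

/-- The affine Dunkl operators commute. -/
lemma dunkl_comm (hk : D.IsMultiplicity k) (u v : Vhat V) :
    D.dunkl k π u * D.dunkl k π v = D.dunkl k π v * D.dunkl k π u := by
  suffices h : ∀ C : D.Chamber, ∀ u v f,
      (D.dunkl k π u * D.dunkl k π v - D.dunkl k π v * D.dunkl k π u) f C = 0 from
    sub_eq_zero.1 (LinearMap.ext fun f => funext fun C => h C u v f)
  refine D.chamber_induction ?_ fun a ha C ih u v f => ?_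
  · intro u v f
    rw [LinearMap.sub_apply, Pi.sub_apply, Module.End.mul_apply, Module.End.mul_apply,
      dunkl_fundChamber, dunkl_fundChamber, dunkl_fundChamber, dunkl_fundChamber,
      ← LinearMap.rTensor_comp_apply, ← LinearMap.rTensor_comp_apply, partialDeriv_comm, sub_self]
  -- Feeding in `s_a u`, `s_a v` and `s_a f` makes the right side `[D_u, D_v] f`; its component at
  -- `C` is the image of a commutator's component at `s_a C`.
  · have h := LinearMap.congr_fun (D.act_simple_mul_commutator π hk a ha (refl a.1 u)
      (refl a.1 v)) (D.act π (D.s a) f)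
    have h1 : D.act π (D.s a) (D.act π (D.s a) f) = f := by
      rw [← Module.End.mul_apply, ← act_mul, s_mul_self, act_one]; rfl
    rw [refl_refl, refl_refl, Module.End.mul_apply _ (D.act π (D.s a)), h1] at h
    rw [← h, Module.End.mul_apply, act_apply, s_inv, ih, map_zero]

end Dunkl

end AffineDatum

/-! ### Symmetric algebras -/

section Symmetric

variable {N A : Type*} [AddCommGroup N] [Module ℂ N] [Ring A] [Algebra ℂ A]

/-- The universal property needs a commutative target, so the lift goes through the subalgebra
generated by the commuting image of `g`. -/
lemma exists_symmetricAlgebra_lift (g : N →ₗ[ℂ] A) (hg : ∀ x y, g x * g y = g y * g x) :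
    ∃ F : SymmetricAlgebra ℂ N →ₐ[ℂ] A, ∀ x, F (SymmetricAlgebra.ι ℂ N x) = g x := by
  have hcomm : ∀ a ∈ Set.range g, ∀ b ∈ Set.range g, a * b = b * a := by
    rintro _ ⟨x, rfl⟩ _ ⟨y, rfl⟩
    exact hg x y
  have := Algebra.isMulCommutative_adjoin ℂ hcomm
  let : CommRing (Algebra.adjoin ℂ (Set.range g)) :=
    { mul_comm := fun a b => mul_comm' a b }
  let g' : N →ₗ[ℂ] Algebra.adjoin ℂ (Set.range g) :=
    g.codRestrict (Subalgebra.toSubmodule (Algebra.adjoin ℂ (Set.range g)))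
      fun x => Algebra.subset_adjoin ⟨x, rfl⟩
  refine ⟨(Algebra.adjoin ℂ (Set.range g)).val.comp (SymmetricAlgebra.lift g'), fun x => ?_⟩
  rw [AlgHom.comp_apply, SymmetricAlgebra.lift_ι_apply]
  rfl

lemma symmetricAlgebra_algHom_ext {F G : SymmetricAlgebra ℂ N →ₐ[ℂ] A}
    (h : ∀ x, F (SymmetricAlgebra.ι ℂ N x) = G (SymmetricAlgebra.ι ℂ N x)) : F = G := by
  refine AlgHom.ext fun p => ?_
  induction p using SymmetricAlgebra.induction with
  | algebraMap r => rw [AlgHom.commutes, AlgHom.commutes]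
  | ι x => exact h x
  | mul p q hp hq => rw [map_mul, map_mul, hp, hq]
  | add p q hp hq => rw [map_add, map_add, hp, hq]

/-- In a basis this says that a polynomial over the infinite field `ℂ` vanishing at every point is
zero. -/
lemma symmetricAlgebra_eq_zero {p : SymmetricAlgebra ℂ N}
    (h : ∀ l : Module.Dual ℂ N, SymmetricAlgebra.lift l p = 0) : p = 0 := by
  have b := Module.Basis.ofVectorSpace ℂ N
  rw [← map_eq_zero_iff _ (SymmetricAlgebra.equivMvPolynomial b).injective]
  refine MvPolynomial.funext fun x => ?_
  have hx : (MvPolynomial.aeval x).comp (SymmetricAlgebra.equivMvPolynomial b).toAlgHom =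
      SymmetricAlgebra.lift (b.constr ℂ x) := by
    refine SymmetricAlgebra.algHom_ext (b.ext fun i => ?_)
    simp
  rw [map_zero, ← h (b.constr ℂ x), ← hx]
  rfl

lemma hhat_induction {V : Type*} [AddCommGroup V] [Module ℝ V] {p : Hhat V → Prop}
    (hv : ∀ v : Vhat V, p ((1 : ℂ) ⊗ₜ v)) (hsmul : ∀ (z : ℂ) x, p x → p (z • x))
    (hadd : ∀ x y, p x → p y → p (x + y)) (x : Hhat V) : p x := by
  induction x using TensorProduct.induction_on with
  | zero => simpa using hv 0
  | tmul z v => simpa [TensorProduct.smul_tmul'] using hsmul z _ (hv v)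
  | add x y hx hy => exact hadd x y hx hy

lemma exists_complexify {V : Type*} [AddCommGroup V] [Module ℝ V] (f : Vhat V → A)
    (hadd : ∀ u v, f (u + v) = f u + f v) (hsmul : ∀ (r : ℝ) v, f (r • v) = (r : ℂ) • f v) :
    ∃ g : Hhat V →ₗ[ℂ] A, ∀ v, g ((1 : ℂ) ⊗ₜ v) = f v := by
  let f' : Vhat V →ₗ[ℝ] A := { toFun := f, map_add' := hadd, map_smul' := hsmul }
  exact ⟨f'.liftBaseChange ℂ, fun v => by simp [f']⟩

end Symmetric

/-! ### The cross relations -/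

section Cross

variable {ι V : Type*} [NormedAddCommGroup V] [InnerProductSpace ℝ V] (D : AffineDatum ι V)
  (k : D.affRoots → ℂ) {A : Type*} [Ring A] [Algebra ℂ A]

/-- The cross relations of the extended trigonometric Cherednik algebra, for a pair of morphisms
from the symmetric algebra and from the group algebra. -/
structure CrossRelations (fS : SymmetricAlgebra ℂ (Hhat V) →ₐ[ℂ] A)
    (fW : MonoidAlgebra ℂ D.extWeyl →ₐ[ℂ] A) : Prop where
  simple : ∀ (a : D.affRoots), a.1 ∈ D.affSimple → ∀ v : Hhat V,
    fW (MonoidAlgebra.of ℂ _ (D.s a)) * fS (SymmetricAlgebra.ι ℂ _ v) =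
      fS (SymmetricAlgebra.ι ℂ _ ((refl a.1).toLinearMap.baseChange ℂ v)) *
        fW (MonoidAlgebra.of ℂ _ (D.s a)) - algebraMap ℂ A (k a * formC a.1 v)
  omega : ∀ ω : D.extWeyl, D.IsOmega ω → ∀ v : Hhat V,
    fW (MonoidAlgebra.of ℂ _ ω) * fS (SymmetricAlgebra.ι ℂ _ v) =
      fS (SymmetricAlgebra.ι ℂ _ (ω.1.toLinearMap.baseChange ℂ v)) *
        fW (MonoidAlgebra.of ℂ _ ω)

/-- The multiplication map `p ⊗ g ↦ p g`. -/
def mulMap {D : AffineDatum ι V} (fS : SymmetricAlgebra ℂ (Hhat V) →ₐ[ℂ] A)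
    (fW : MonoidAlgebra ℂ D.extWeyl →ₐ[ℂ] A) :
    SymmetricAlgebra ℂ (Hhat V) ⊗[ℂ] MonoidAlgebra ℂ D.extWeyl →ₗ[ℂ] A :=
  LinearMap.mul' ℂ A ∘ₗ TensorProduct.map fS.toLinearMap fW.toLinearMap

variable {D k} {fS : SymmetricAlgebra ℂ (Hhat V) →ₐ[ℂ] A}
  {fW : MonoidAlgebra ℂ D.extWeyl →ₐ[ℂ] A}

lemma mulMap_tmul (p : SymmetricAlgebra ℂ (Hhat V)) (g : MonoidAlgebra ℂ D.extWeyl) :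
    mulMap fS fW (p ⊗ₜ g) = fS p * fW g := rfl

lemma mul_mem_range_left (p : SymmetricAlgebra ℂ (Hhat V)) {n : A}
    (hn : n ∈ LinearMap.range (mulMap fS fW)) : fS p * n ∈ LinearMap.range (mulMap fS fW) := by
  obtain ⟨z, rfl⟩ := hn
  induction z using TensorProduct.induction_on with
  | zero => simp
  | tmul q g => exact ⟨(p * q) ⊗ₜ g, by rw [mulMap_tmul, mulMap_tmul, map_mul, mul_assoc]⟩
  | add z z' hz hz' => rw [map_add, mul_add]; exact add_mem hz hz'

lemma algebraMap_mul_mem_range (r : ℂ) {n : A} (hn : n ∈ LinearMap.range (mulMap fS fW)) :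
    algebraMap ℂ A r * n ∈ LinearMap.range (mulMap fS fW) := by
  rw [← Algebra.smul_def]
  exact Submodule.smul_mem _ r hn

/-- An element with a cross relation can be pushed to the right past polynomials, at the cost of
terms already in the span. -/
lemma mul_mem_range_of_cross {x : A} (σ : Hhat V → Hhat V) (κ : Hhat V → ℂ)
    (hx : ∀ v, x * fS (SymmetricAlgebra.ι ℂ _ v) =
      fS (SymmetricAlgebra.ι ℂ _ (σ v)) * x - algebraMap ℂ A (κ v))
    (hxW : ∀ g, x * fW g ∈ LinearMap.range (mulMap fS fW)) {n : A}
    (hn : n ∈ LinearMap.range (mulMap fS fW)) : x * n ∈ LinearMap.range (mulMap fS fW) := by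
  -- Quantifying over all `n` with both `n` and `x n` in the span makes the claim multiplicative in
  -- `p`: for `p q`, it is applied to `q n`.
  have key : ∀ p : SymmetricAlgebra ℂ (Hhat V), ∀ n ∈ LinearMap.range (mulMap fS fW),
      x * n ∈ LinearMap.range (mulMap fS fW) →
        x * (fS p * n) ∈ LinearMap.range (mulMap fS fW) := by
    intro p
    induction p using SymmetricAlgebra.induction with
    | algebraMap r =>
      intro n _ hxn
      rw [AlgHom.commutes, ← mul_assoc, ← Algebra.commutes, mul_assoc]
      exact algebraMap_mul_mem_range r hxn
    | ι v =>
      intro n hn hxn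
      rw [← mul_assoc, hx, sub_mul, mul_assoc]
      exact sub_mem (mul_mem_range_left _ hxn) (algebraMap_mul_mem_range _ hn)
    | mul p q hp hq =>
      intro n hn hxn
      rw [map_mul, mul_assoc]
      exact hp _ (mul_mem_range_left q hn) (hq n hn hxn)
    | add p q hp hq =>
      intro n hn hxn
      rw [map_add, add_mul, mul_add]
      exact add_mem (hp n hn hxn) (hq n hn hxn)
  obtain ⟨z, rfl⟩ := hn
  induction z using TensorProduct.induction_on with
  | zero => simp
  | tmul p g =>
    exact key p (fW g) ⟨1 ⊗ₜ g, by rw [mulMap_tmul, map_one, one_mul]⟩ (hxW g)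
  | add z z' hz hz' => rw [map_add, mul_add]; exact add_mem hz hz'

lemma map_mem_range (g : MonoidAlgebra ℂ D.extWeyl) : fW g ∈ LinearMap.range (mulMap fS fW) :=
  ⟨1 ⊗ₜ g, by rw [mulMap_tmul, map_one, one_mul]⟩

/-! ### The span of the products `p w` as a subalgebra -/

namespace CrossRelations

variable [FiniteDimensional ℝ V]

lemma of_mul_mem_range (h : CrossRelations D k fS fW) (w : D.extWeyl) {n : A}
    (hn : n ∈ LinearMap.range (mulMap fS fW)) :
    fW (MonoidAlgebra.of ℂ _ w) * n ∈ LinearMap.range (mulMap fS fW) := by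
  have hW : ∀ w g, fW (MonoidAlgebra.of ℂ _ w) * fW g ∈ LinearMap.range (mulMap fS fW) :=
    fun w g => by rw [← map_mul]; exact map_mem_range _
  revert n
  refine D.generators_induction
    (p := fun w => ∀ {n}, n ∈ LinearMap.range (mulMap fS fW) →
      fW (MonoidAlgebra.of ℂ _ w) * n ∈ LinearMap.range (mulMap fS fW)) ?_ ?_ w
  · intro ω hω n hn
    exact mul_mem_range_of_cross _ 0 (fun v => by simpa using h.omega ω hω v) (hW ω) hn
  · intro a ha w hw n hn
    rw [map_mul, map_mul, mul_assoc]
    exact mul_mem_range_of_cross _ _ (h.simple a ha) (hW _) (hw hn)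

/-- The image of the multiplication map is a subalgebra. -/
def rangeSubalgebra (h : CrossRelations D k fS fW) : Subalgebra ℂ A where
  __ := LinearMap.range (mulMap fS fW)
  mul_mem' := by
    rintro x n ⟨z, rfl⟩ hn
    change mulMap fS fW z * n ∈ LinearMap.range (mulMap fS fW)
    induction z using TensorProduct.induction_on with
    | zero => simp
    | tmul p g =>
      rw [mulMap_tmul, mul_assoc]
      refine mul_mem_range_left p ?_
      induction g using MonoidAlgebra.induction_on with
      | of w => exact h.of_mul_mem_range w hn
      | add g g' hg hg' => rw [map_add, add_mul]; exact add_mem hg hg'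
      | smul r g hg => rw [map_smul, smul_mul_assoc]; exact Submodule.smul_mem _ r hg
    | add z z' hz hz' => rw [map_add, add_mul]; exact add_mem hz hz'
  algebraMap_mem' r := ⟨algebraMap ℂ _ r ⊗ₜ 1, by
    rw [mulMap_tmul, AlgHom.commutes, map_one, mul_one]⟩

lemma apply_mem_rangeSubalgebra (h : CrossRelations D k fS fW)
    (p : SymmetricAlgebra ℂ (Hhat V)) : fS p ∈ h.rangeSubalgebra :=
  ⟨p ⊗ₜ 1, by rw [mulMap_tmul, map_one, mul_one]⟩

lemma apply_mem_rangeSubalgebra' (h : CrossRelations D k fS fW)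
    (g : MonoidAlgebra ℂ D.extWeyl) : fW g ∈ h.rangeSubalgebra :=
  map_mem_range g

end CrossRelations

lemma CrossRelations.prod {B : Type*} [Ring B] [Algebra ℂ B]
    {gS : SymmetricAlgebra ℂ (Hhat V) →ₐ[ℂ] B} {gW : MonoidAlgebra ℂ D.extWeyl →ₐ[ℂ] B}
    (hf : CrossRelations D k fS fW) (hg : CrossRelations D k gS gW) :
    CrossRelations D k (fS.prod gS) (fW.prod gW) where
  simple a ha v := Prod.ext (hf.simple a ha v) (hg.simple a ha v)
  omega ω hω v := Prod.ext (hf.omega ω hω v) (hg.omega ω hω v)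

lemma fst_mulMap_prod {B : Type*} [Ring B] [Algebra ℂ B]
    (gS : SymmetricAlgebra ℂ (Hhat V) →ₐ[ℂ] B) (gW : MonoidAlgebra ℂ D.extWeyl →ₐ[ℂ] B)
    (z : SymmetricAlgebra ℂ (Hhat V) ⊗[ℂ] MonoidAlgebra ℂ D.extWeyl) :
    (mulMap (fS.prod gS) (fW.prod gW) z).1 = mulMap fS fW z := by
  induction z using TensorProduct.induction_on with
  | zero => simp
  | tmul p g => rfl
  | add z z' hz hz' => rw [map_add, map_add, Prod.fst_add, hz, hz']

/-! ### Universal property and uniqueness -/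

namespace CherednikStructure

variable {H : Type*} [Ring H] [Algebra ℂ H]

lemma crossRelations (h : CherednikStructure D k H) : CrossRelations D k h.incS h.incW :=
  ⟨h.cross_simple, h.cross_omega⟩

lemma algHom_ext (h : CherednikStructure D k H) {F G : H →ₐ[ℂ] A}
    (hS : ∀ v : Vhat V, F (h.incS (SymmetricAlgebra.ι ℂ _ ((1 : ℂ) ⊗ₜ v))) =
      G (h.incS (SymmetricAlgebra.ι ℂ _ ((1 : ℂ) ⊗ₜ v))))
    (hW : ∀ w : D.extWeyl, F (h.incW (MonoidAlgebra.of ℂ _ w)) =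
      G (h.incW (MonoidAlgebra.of ℂ _ w))) : F = G := by
  have hS' : F.comp h.incS = G.comp h.incS := symmetricAlgebra_algHom_ext fun x => by
    induction x using hhat_induction with
    | hv v => exact hS v
    | hsmul z x hx => rw [map_smul, map_smul, map_smul, hx]
    | hadd x y hx hy => rw [map_add, map_add, map_add, hx, hy]
  have hW' : F.comp h.incW = G.comp h.incW := AlgHom.ext fun g => by
    induction g using MonoidAlgebra.induction_on with
    | of w => exact hW w
    | add g g' hg hg' => rw [map_add, map_add, hg, hg']
    | smul r g hg => rw [map_smul, map_smul, hg]
  refine AlgHom.ext fun x => ?_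
  obtain ⟨z, rfl⟩ := h.mul_bijective.2 x
  change F (mulMap h.incS h.incW z) = G (mulMap h.incS h.incW z)
  induction z using TensorProduct.induction_on with
  | zero => simp
  | tmul p g =>
    rw [mulMap_tmul, map_mul, map_mul]
    exact congrArg₂ _ (AlgHom.congr_fun hS' p) (AlgHom.congr_fun hW' g)
  | add z z' hz hz' => rw [map_add, map_add, map_add, hz, hz']

variable [FiniteDimensional ℝ V]

/-- The universal property of the extended trigonometric Cherednik algebra. -/
lemma exists_lift (h : CherednikStructure D k H) (hf : CrossRelations D k fS fW) :
    ∃ F : H →ₐ[ℂ] A, (∀ p, F (h.incS p) = fS p) ∧ ∀ g, F (h.incW g) = fW g := by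
  set hp := h.crossRelations.prod hf with hp_def
  let R := hp.rangeSubalgebra
  -- Both `R` and `H` are images of the same tensor product. As multiplication is bijective onto
  -- `H`, the first projection is an isomorphism, and its inverse followed by the second projection
  -- is the lift.
  let e : R →ₐ[ℂ] H := (AlgHom.fst ℂ H A).comp R.val
  have he : Function.Bijective e := by
    refine ⟨(injective_iff_map_eq_zero e).2 ?_, fun x => ?_⟩
    · rintro ⟨_, z, rfl⟩ hz
      have hz' : mulMap h.incS h.incW z = 0 := (fst_mulMap_prod fS fW z).symm.trans hz
      have hz0 : z = 0 := h.mul_bijective.1 (hz'.trans (map_zero _).symm)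
      exact Subtype.ext (by change mulMap _ _ z = 0; rw [hz0, map_zero])
    · obtain ⟨z, rfl⟩ := h.mul_bijective.2 x
      exact ⟨⟨_, z, rfl⟩, fst_mulMap_prod fS fW z⟩
  let e' := AlgEquiv.ofBijective e he
  have hsymm : ∀ x : R, e'.symm (x.1.1) = x := fun x => e'.symm_apply_apply x
  refine ⟨((AlgHom.snd ℂ H A).comp R.val).comp e'.symm.toAlgHom, fun p => ?_, fun g => ?_⟩
  · exact congrArg (fun x : R => x.1.2) (hsymm ⟨_, hp.apply_mem_rangeSubalgebra p⟩)
  · exact congrArg (fun x : R => x.1.2) (hsymm ⟨_, hp.apply_mem_rangeSubalgebra' g⟩)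

lemma existsUnique_algEquiv {H' : Type*} [Ring H'] [Algebra ℂ H'] (h : CherednikStructure D k H)
    (h' : CherednikStructure D k H') :
    ∃! e : H ≃ₐ[ℂ] H', (∀ p, e (h.incS p) = h'.incS p) ∧ ∀ g, e (h.incW g) = h'.incW g := by
  obtain ⟨F, hFS, hFW⟩ := h.exists_lift h'.crossRelations
  obtain ⟨G, hGS, hGW⟩ := h'.exists_lift h.crossRelations
  refine ⟨AlgEquiv.ofAlgHom F G (h'.algHom_ext ?_ ?_) (h.algHom_ext ?_ ?_), ⟨hFS, hFW⟩,
    fun e he => ?_⟩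
  · intro v; simp [hFS, hGS]
  · intro w; simp only [AlgHom.comp_apply, hFW, hGW, AlgHom.id_apply]
  · intro v; simp [hFS, hGS]
  · intro w; simp only [AlgHom.comp_apply, hFW, hGW, AlgHom.id_apply]
  · have : e.toAlgHom = F := h.algHom_ext (fun v => (he.1 _).trans (hFS _).symm)
      fun w => (he.2 _).trans (hFW _).symm
    exact AlgEquiv.ext fun x => AlgHom.congr_fun this x

end CherednikStructure

/-- If the multiplication map is injective, then its image is an extended trigonometric Cherednik
algebra. -/
def CrossRelations.cherednikStructure [FiniteDimensional ℝ V] (h : CrossRelations D k fS fW)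
    (hinj : Function.Injective (mulMap fS fW)) : CherednikStructure D k h.rangeSubalgebra where
  incS := fS.codRestrict _ h.apply_mem_rangeSubalgebra
  incW := fW.codRestrict _ h.apply_mem_rangeSubalgebra'
  incS_injective p q hpq := by
    -- Injectivity on each factor follows from that of the multiplication map, through `p ↦ p ⊗ 1`
    -- here and `g ↦ 1 ⊗ g` below.
    refine Algebra.TensorProduct.includeLeft_injective (S := ℂ)
      (B := MonoidAlgebra ℂ D.extWeyl) (algebraMap ℂ _).injective (hinj ?_)
    have hpq' : fS p = fS q := congrArg Subtype.val hpq
    change mulMap fS fW (p ⊗ₜ 1) = mulMap fS fW (q ⊗ₜ 1)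
    rw [mulMap_tmul, mulMap_tmul, hpq']
  incW_injective g g' hg := by
    refine Algebra.TensorProduct.includeRight_injective
      (A := SymmetricAlgebra ℂ (Hhat V)) (SymmetricAlgebra.algebraMap_leftInverse _).injective
      (hinj ?_)
    have hg' : fW g = fW g' := congrArg Subtype.val hg
    change mulMap fS fW (1 ⊗ₜ g) = mulMap fS fW (1 ⊗ₜ g')
    rw [mulMap_tmul, mulMap_tmul, hg']
  mul_bijective := by
    have key : ∀ z, ((mulMap (fS.codRestrict _ h.apply_mem_rangeSubalgebra)
        (fW.codRestrict _ h.apply_mem_rangeSubalgebra') z : h.rangeSubalgebra) : A) =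
        mulMap fS fW z := fun z => by
      induction z using TensorProduct.induction_on with
      | zero => simp
      | tmul p g => rfl
      | add z z' hz hz' => rw [map_add, map_add, ← hz, ← hz']; rfl
    refine ⟨fun z z' hz => hinj ?_, ?_⟩
    · rw [← key, ← key]
      exact congrArg Subtype.val hz
    · rintro ⟨_, z, rfl⟩
      exact ⟨z, Subtype.ext (key z)⟩
  cross_simple a ha v := Subtype.ext (h.simple a ha v)
  cross_omega ω hω v := Subtype.ext (h.omega ω hω v)

end Cross

/-! ### The representation by affine Dunkl operators -/

lemma formC_tmul_one {V : Type*} [NormedAddCommGroup V] [InnerProductSpace ℝ V] (a v : Vhat V) :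
    formC a ((1 : ℂ) ⊗ₜ v) = (form a v : ℝ) := by
  simp [formC]

namespace AffineDatum

/-- The tensor product is spanned over the symmetric algebra by the group elements; only existence
of the expansion is used. -/
lemma exists_sum_tmul {ι V : Type*} [NormedAddCommGroup V] [InnerProductSpace ℝ V]
    (D : AffineDatum ι V)
    (z : SymmetricAlgebra ℂ (Hhat V) ⊗[ℂ] MonoidAlgebra ℂ D.extWeyl) :
    ∃ p : D.extWeyl →₀ SymmetricAlgebra ℂ (Hhat V),
      z = p.sum fun w q => q ⊗ₜ MonoidAlgebra.of ℂ _ w := by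
  classical
  have hadd : ∀ z z' : SymmetricAlgebra ℂ (Hhat V) ⊗[ℂ] MonoidAlgebra ℂ D.extWeyl,
      (∃ p : D.extWeyl →₀ SymmetricAlgebra ℂ (Hhat V),
        z = p.sum fun w q => q ⊗ₜ MonoidAlgebra.of ℂ _ w) →
      (∃ p : D.extWeyl →₀ SymmetricAlgebra ℂ (Hhat V),
        z' = p.sum fun w q => q ⊗ₜ MonoidAlgebra.of ℂ _ w) →
      ∃ p : D.extWeyl →₀ SymmetricAlgebra ℂ (Hhat V),
        z + z' = p.sum fun w q => q ⊗ₜ MonoidAlgebra.of ℂ _ w := by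
    rintro _ _ ⟨p, rfl⟩ ⟨p', rfl⟩
    exact ⟨p + p', (Finsupp.sum_add_index' (h := fun w q => q ⊗ₜ[ℂ] MonoidAlgebra.of ℂ _ w)
      (fun w => TensorProduct.zero_tmul _ _)
      fun w q q' => TensorProduct.add_tmul _ _ _).symm⟩
  induction z using TensorProduct.induction_on with
  | zero => exact ⟨0, by simp⟩
  | add z z' hz hz' => exact hadd z z' hz hz'
  | tmul p g =>
    induction g using MonoidAlgebra.induction_on generalizing p with
    | of w =>
      exact ⟨Finsupp.single w p, (Finsupp.sum_single_index
        (h := fun w q => q ⊗ₜ[ℂ] MonoidAlgebra.of ℂ _ w) (TensorProduct.zero_tmul _ _)).symm⟩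
    | add g g' hg hg' => rw [TensorProduct.tmul_add]; exact hadd _ _ (hg p) (hg' p)
    | smul r g hg => rw [TensorProduct.tmul_smul, TensorProduct.smul_tmul']; exact hg (r • p)

section DunklRepresentation

variable {ι V : Type*} [NormedAddCommGroup V] [InnerProductSpace ℝ V] [FiniteDimensional ℝ V]
  (D : AffineDatum ι V) {k : D.affRoots → ℂ} {M : Type*} [AddCommGroup M] [Module ℂ M]
  (π : Representation ℂ D.extWeyl M)

/-- The action on `F_M` as a morphism from the group algebra. -/
def actHom : MonoidAlgebra ℂ D.extWeyl →ₐ[ℂ] Module.End ℂ (D.FM M) :=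
  MonoidAlgebra.lift ℂ _ _
    { toFun := D.act π
      map_one' := D.act_one π
      map_mul' := D.act_mul π }

lemma actHom_of (w : D.extWeyl) : D.actHom π (MonoidAlgebra.of ℂ _ w) = D.act π w :=
  MonoidAlgebra.lift_of _ w

lemma exists_dunklHom (hk : D.IsMultiplicity k) :
    ∃ fS : SymmetricAlgebra ℂ (Hhat V) →ₐ[ℂ] Module.End ℂ (D.FM M),
      (∀ v : Vhat V, fS (SymmetricAlgebra.ι ℂ _ ((1 : ℂ) ⊗ₜ v)) = D.dunkl k π v) ∧
        CrossRelations D k fS (D.actHom π) := by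
  obtain ⟨g, hg⟩ := exists_complexify (D.dunkl k π) (D.dunkl_add k π) (D.dunkl_smul k π)
  have hcomm : ∀ x y, g x * g y = g y * g x := by
    intro x y
    induction x using hhat_induction with
    | hv u =>
      induction y using hhat_induction with
      | hv v => rw [hg, hg, D.dunkl_comm π hk]
      | hsmul z y hy => rw [map_smul, mul_smul_comm, smul_mul_assoc, hy]
      | hadd x y hx hy => rw [map_add, mul_add, add_mul, hx, hy]
    | hsmul z x hx => rw [map_smul, mul_smul_comm, smul_mul_assoc, hx]
    | hadd x x' hx hx' => rw [map_add, mul_add, add_mul, hx, hx']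
  obtain ⟨fS, hfS⟩ := exists_symmetricAlgebra_lift g hcomm
  refine ⟨fS, fun v => by rw [hfS, hg], ?_, ?_⟩
  · intro a ha x
    have hadd : ∀ x y, formC a.1 (x + y) = formC a.1 x + formC a.1 y := fun x y => map_add _ x y
    have hsmul : ∀ (z : ℂ) x, formC a.1 (z • x) = z * formC a.1 x := fun z x => map_smul _ z x
    simp only [hfS, actHom_of]
    induction x using hhat_induction with
    | hv v =>
      rw [LinearMap.baseChange_tmul, formC_tmul_one, hg, D.act_simple_mul_dunkl π hk a ha,
        LinearEquiv.coe_coe, hg]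
    | hsmul z x hx =>
      rw [map_smul, map_smul, map_smul, mul_smul_comm, hx, smul_mul_assoc, smul_sub, hsmul,
        mul_left_comm, map_mul _ z, Algebra.smul_def z (algebraMap ℂ _ _)]
    | hadd x y hx hy =>
      rw [map_add, map_add, map_add, mul_add, hx, hy, add_mul, hadd, mul_add, map_add]
      abel
  · intro ω hω x
    simp only [hfS, actHom_of]
    induction x using hhat_induction with
    | hv v =>
      rw [LinearMap.baseChange_tmul, hg, D.act_isOmega_mul_dunkl π hk hω, LinearEquiv.coe_coe, hg]
    | hsmul z x hx => rw [map_smul, map_smul, map_smul, mul_smul_comm, hx, smul_mul_assoc]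
    | hadd x y hx hy => rw [map_add, map_add, map_add, mul_add, hx, hy, add_mul]

/-- On the fundamental chamber, exponentials are eigenfunctions of the affine Dunkl operators. -/
lemma dunkl_exp_fundChamber {fS : SymmetricAlgebra ℂ (Hhat V) →ₐ[ℂ] Module.End ℂ (D.FM M)}
    (hfS : ∀ v : Vhat V, fS (SymmetricAlgebra.ι ℂ _ ((1 : ℂ) ⊗ₜ v)) = D.dunkl k π v)
    (l : Module.Dual ℂ (Hhat V)) (p : SymmetricAlgebra ℂ (Hhat V)) (m : M) (f : D.FM M)
    (hf : f D.fundChamber = expAnalytic l ⊗ₜ m) :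
    fS p f D.fundChamber = expAnalytic l ⊗ₜ (SymmetricAlgebra.lift l p • m) := by
  -- Only the fundamental component of `f` is constrained, so the product case can reuse the claim
  -- for `fS q f` with a rescaled `m`.
  induction p using SymmetricAlgebra.induction generalizing m f with
  | algebraMap r =>
    rw [AlgHom.commutes, AlgHom.commutes, Module.algebraMap_end_apply, Pi.smul_apply, hf,
      TensorProduct.tmul_smul]
    rfl
  | ι x =>
    rw [SymmetricAlgebra.lift_ι_apply]
    induction x using hhat_induction with
    | hv v =>
      rw [hfS, dunkl_fundChamber, hf, LinearMap.rTensor_tmul, partialDeriv_expAnalytic,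
        TensorProduct.smul_tmul]
    | hsmul z x hx =>
      rw [map_smul, map_smul, LinearMap.smul_apply, Pi.smul_apply, hx, map_smul, smul_assoc,
        TensorProduct.tmul_smul, TensorProduct.tmul_smul, TensorProduct.tmul_smul]
    | hadd x y hx hy =>
      rw [map_add, map_add, LinearMap.add_apply, Pi.add_apply, hx, hy, map_add, add_smul,
        TensorProduct.tmul_add]
  | mul p q hp hq =>
    rw [map_mul, Module.End.mul_apply, hp _ _ (hq m f hf), map_mul, mul_smul]
  | add p q hp hq =>
    rw [map_add, LinearMap.add_apply, Pi.add_apply, hp m f hf, hq m f hf, map_add, add_smul,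
      TensorProduct.tmul_add]

/-- For the regular representation, the representation by affine Dunkl operators is faithful. -/
lemma mulMap_dunkl_injective {fS : SymmetricAlgebra ℂ (Hhat V) →ₐ[ℂ]
      Module.End ℂ (D.FM (MonoidAlgebra ℂ D.extWeyl))}
    (hfS : ∀ v : Vhat V, fS (SymmetricAlgebra.ι ℂ _ ((1 : ℂ) ⊗ₜ v)) =
      D.dunkl k (Representation.leftRegular ℂ D.extWeyl) v) :
    Function.Injective (mulMap fS (D.actHom (Representation.leftRegular ℂ D.extWeyl))) := by
  classical
  set π := Representation.leftRegular ℂ D.extWeyl with hπ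
  refine (injective_iff_map_eq_zero _).2 fun z hz => ?_
  obtain ⟨p, rfl⟩ := D.exists_sum_tmul z
  have key : ∀ (l : Module.Dual ℂ (Hhat V)) (w₀ : D.extWeyl),
      SymmetricAlgebra.lift (l ∘ₗ w₀⁻¹.1.toLinearMap.baseChange ℂ) (p w₀) = 0 := by
    intro l w₀
    have hact : ∀ w, D.act π w (fun _ => expAnalytic l ⊗ₜ MonoidAlgebra.of ℂ _ 1) D.fundChamber =
        expAnalytic (l ∘ₗ w⁻¹.1.toLinearMap.baseChange ℂ) ⊗ₜ MonoidAlgebra.of ℂ _ w := by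
      intro w
      rw [act_apply, TensorProduct.map_tmul, pull_expAnalytic, hπ, MonoidAlgebra.of_apply,
        Representation.leftRegular, Representation.ofMulAction_single]
      simp
    have h := congrFun (LinearMap.congr_fun hz
      (fun _ => expAnalytic l ⊗ₜ MonoidAlgebra.of ℂ _ 1)) D.fundChamber
    rw [Finsupp.sum, map_sum, LinearMap.sum_apply, Finset.sum_apply] at h
    simp only [mulMap_tmul, actHom_of, Module.End.mul_apply] at h
    rw [Finset.sum_congr rfl fun w _ => D.dunkl_exp_fundChamber π hfS _ (p w) _ _ (hact w)] at h
    -- Extracting the coefficient of `w₀` in the group algebra isolates one exponential, so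
    -- independence of exponentials is not needed.
    have h1 := congrArg (TensorProduct.rid ℂ _ ∘ LinearMap.lTensor (Analytic V)
      (Finsupp.lapply w₀ ∘ₗ (MonoidAlgebra.coeffLinearEquiv ℂ).toLinearMap)) h
    simp only [Function.comp_apply, map_sum, LinearMap.lTensor_tmul, LinearMap.zero_apply,
      Pi.zero_apply, map_zero, TensorProduct.rid_tmul] at h1
    have hcoeff : ∀ (r : ℂ) (w : D.extWeyl), (Finsupp.lapply w₀ ∘ₗ
        (MonoidAlgebra.coeffLinearEquiv ℂ).toLinearMap) (r • MonoidAlgebra.of ℂ _ w) =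
          if w = w₀ then r else 0 := by
      intro r w
      simp [Finsupp.single_apply]
    simp only [hcoeff, ite_smul, zero_smul] at h1
    rw [Finset.sum_ite_eq'] at h1
    by_cases hw : w₀ ∈ p.support
    · rw [if_pos hw] at h1
      exact (smul_eq_zero.1 h1).resolve_right (expAnalytic_ne_zero _)
    · rw [Finsupp.notMem_support_iff.1 hw, map_zero]
  have hp : p = 0 := Finsupp.ext fun w => symmetricAlgebra_eq_zero fun l => by
    -- Precomposing `l` with `w` undoes the twist by `w⁻¹`, so every point of the dual is reached.
    have h := key (l ∘ₗ w.1.toLinearMap.baseChange ℂ) w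
    rwa [LinearMap.comp_assoc, ← LinearMap.baseChange_comp,
      show w.1.toLinearMap ∘ₗ w⁻¹.1.toLinearMap = LinearMap.id from
        LinearMap.ext (D.apply_inv_apply w), LinearMap.baseChange_id, LinearMap.comp_id] at h
  rw [hp, Finsupp.sum_zero_index]

end DunklRepresentation

end AffineDatum

end Cherednik

end

theorem mainTheorem4 {ι : Type u₂} {V : Type u₁} [NormedAddCommGroup V] [InnerProductSpace ℝ V]
    [FiniteDimensional ℝ V] (D : Cherednik.AffineDatum ι V)
    (k : D.affRoots → ℂ) (hk : D.IsMultiplicity k) :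
    ((∃ (H : Type u₁) (_ : Ring H) (_ : Algebra ℂ H),
        Nonempty (Cherednik.CherednikStructure D k H)) ∧
      ∀ (H : Type u₃) [Ring H] [Algebra ℂ H] (H' : Type u₄) [Ring H'] [Algebra ℂ H']
        (h : Cherednik.CherednikStructure D k H) (h' : Cherednik.CherednikStructure D k H'),
        ∃! e : H ≃ₐ[ℂ] H',
          (∀ p, e (h.incS p) = h'.incS p) ∧ ∀ g, e (h.incW g) = h'.incW g) ∧
    (∀ C : D.Chamber, {a | a ∈ D.posRoots ∧ D.chi a C ≠ 0}.Finite) ∧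
    ∀ (H : Type u₃) [Ring H] [Algebra ℂ H] (h : Cherednik.CherednikStructure D k H)
      (M : Type u₅) [AddCommGroup M] [Module ℂ M] [FiniteDimensional ℂ M]
      (π : Representation ℂ D.extWeyl M),
      ∃! πhat : H →ₐ[ℂ] Module.End ℂ (D.FM M),
        (∀ v : Cherednik.Vhat V,
          πhat (h.incS (SymmetricAlgebra.ι ℂ _ ((1 : ℂ) ⊗ₜ[ℝ] v))) = D.dunkl k π v) ∧
        ∀ w : D.extWeyl, πhat (h.incW (MonoidAlgebra.of ℂ _ w)) = D.act π w := by
  refine ⟨⟨?_, fun H _ _ H' _ _ h h' => h.existsUnique_algEquiv h'⟩, D.finite_chi_ne_zero,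
    fun H _ _ h M _ _ _ π => ?_⟩
  -- The model is the span of the products inside the operators for the regular representation,
  -- where faithfulness is known.
  · obtain ⟨fS, hfS, hcross⟩ :=
      D.exists_dunklHom (Representation.leftRegular ℂ D.extWeyl) hk
    exact ⟨hcross.rangeSubalgebra, inferInstance, inferInstance,
      ⟨hcross.cherednikStructure (D.mulMap_dunkl_injective hfS)⟩⟩
  · obtain ⟨fS, hfS, hcross⟩ := D.exists_dunklHom π hk
    obtain ⟨F, hFS, hFW⟩ := h.exists_lift hcross
    refine ⟨F, ⟨fun v => by rw [hFS, hfS], fun w => by rw [hFW, D.actHom_of]⟩, fun G hG => ?_⟩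
    exact h.algHom_ext (fun v => by rw [hG.1, hFS, hfS])
      fun w => by rw [hG.2, hFW, D.actHom_of]
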